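/- **Conventions.** For a morphism $p\colon X\to Y$ of a category $\mathcal B$ with pullbacks, let $\mathrm{Desc}(p)$ be the category of descent data for $p$: its objects are morphisms $f\colon W\to X$ with an action $h\colon W\times_Y X\to W$ over $X$ (so $f(h(w,x))=x$) satisfying $h(w,f(w))=w$ and $h(h(w,x),x')=h(w,x')$; its morphisms are the morphisms over $X$ that commute with the actions. Pulling back along $p$ gives a comparison functor $\mathcal B/Y\to\mathrm{Desc}(p)$. The morphism $p$ is *effective for descent* (an *effective descent morphism*) if this functor is an equivalence, and an *almost descent morphism* if it is faithful. $\mathrm{Fam}(\mathcal V)$ is the free coproduct completion of $\mathcal V$ (families of objects of $\mathcal V$ indexed by sets); an object of $\mathcal V$ is regarded as a one-member family. For a family of monomorphisms $\iota_i\colon M_i\to Y$ ($i\in I$) in a category with pullbacks, *the join $\bigvee_i M_i$ exists and is isomorphic to $Y$* means that $Y$, with the morphisms $\iota_i$, is a colimit of the diagram formed by the objects $M_i$, the objects $M_i\times_Y M_j$ for all $(i,j)\in I\times I$, and the two projections $M_i\leftarrow M_i\times_Y M_j\to M_j$. It is *stable* if, for every $\omega\colon Z\to Y$, the object $Z$ with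 the pulled back morphisms $\omega^*\iota_i$ is in the same way the join of the $\omega^*M_i$. **Theorem.** Let $\mathcal V$ be a regular category, let $\mathcal V\text{-}\mathrm{Cat}$ be the category of small categories enriched in $\mathcal V$ with its cartesian monoidal structure and of $\mathcal V$-functors, and let $F\colon\mathcal C\to\mathcal D$ be a $\mathcal V$-functor. For an object $y$ of $\mathcal D$ write $F^*y$ for the set of objects $x$ of $\mathcal C$ with $Fx=y$. For all objects $x_0,x_1,x_2,x_3$ of $\mathcal C$ let $$\mathcal C(x_0,x_1)\xrightarrow{P_{x_0,x_1}}M_{x_0,x_1}\xrightarrow{I_{x_0,x_1}}\mathcal D(Fx_0,Fx_1),$$ $$\mathcal C(x_1,x_2)\times\mathcal C(x_0,x_1)\to M_{x_0,x_1,x_2}\xrightarrow{I_{x_0,x_1,x_2}}\mathcal D(Fx_1,Fx_2)\times\mathcal D(Fx_0,Fx_1),$$ $$\mathcal C(x_2,x_3)\times\mathcal C(x_1,x_2)\times\mathcal C(x_0,x_1)\to M_{x_0,x_1,x_2,x_3}\xrightarrow{I_{x_0,x_1,x_2,x_3}}\mathcal D(Fx_2,Fx_3)\times\mathcal D(Fx_1,Fx_2)\times\mathcal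 D(Fx_0,Fx_1)$$ be factorizations of the hom-morphisms of $F$ and of their binary and ternary products as a regular epimorphism followed by a monomorphism. Suppose that 1. $P_{x_0,x_1}$ is an effective descent morphism in $\mathcal V$ for all objects $x_0,x_1$ of $\mathcal C$; 2. for all objects $y_0,y_1$ of $\mathcal D$, the morphism $I\colon(M_{x_0,x_1})_{x_i\in F^*y_i}\to\mathcal D(y_0,y_1)$ is an effective descent morphism in $\mathrm{Fam}(\mathcal V)$; 3. for all objects $y_0,y_1,y_2$ of $\mathcal D$, the join $\bigvee_{x_i\in F^*y_i}M_{x_0,x_1,x_2}$ exists, is stable, and is isomorphic to $\mathcal D(y_1,y_2)\times\mathcal D(y_0,y_1)$; 4. for all objects $y_0,y_1,y_2,y_3$ of $\mathcal D$, the morphism $I\colon(M_{x_0,x_1,x_2,x_3})_{x_i\in F^*y_i}\to\mathcal D(y_2,y_3)\times\mathcal D(y_1,y_2)\times\mathcal D(y_0,y_1)$ is an almost descent morphism in $\mathrm{Fam}(\mathcal V)$. Then $F$ is effective for descent in $\mathcal V\text{-}\mathrm{Cat}$. -/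

import Mathlib

open CategoryTheory CategoryTheory.Limits MonoidalCategory

universe w v u

/-! ## Descent data for a morphism `p : X ⟶ Y` -/

section Descent

variable {C : Type u} [Category.{v} C] [HasPullbacks C] {X Y : C}

/-- Descent data for `p : X ⟶ Y` (with respect to the basic bifibration): a morphism
`str : obj ⟶ X` with an action `act : obj ×_Y X ⟶ obj`, where the pullback is that of `str ≫ p`
and `p`, such that, in generalized elements, `str (act (w, x)) = x`, `act (w, str w) = w` and
`act (act (w, x), x') = act (w, x')`. -/
structure DescentDatum (p : X ⟶ Y) where
  obj : C
  str : obj ⟶ X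
  act : pullback (str ≫ p) p ⟶ obj
  act_str : act ≫ str = pullback.snd (str ≫ p) p
  act_unit : pullback.lift (𝟙 obj) str (by simp) ≫ act = 𝟙 obj
  act_assoc :
    pullback.lift (f := str ≫ p) (g := p)
        (pullback.fst (pullback.snd (str ≫ p) p ≫ p) p ≫ act)
        (pullback.snd (pullback.snd (str ≫ p) p ≫ p) p)
        (by rw [Category.assoc, reassoc_of% act_str, pullback.condition]) ≫ act =
      pullback.lift (f := str ≫ p) (g := p)
        (pullback.fst (pullback.snd (str ≫ p) p ≫ p) p ≫ pullback.fst (str ≫ p) p)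
        (pullback.snd (pullback.snd (str ≫ p) p ≫ p) p)
        (by rw [Category.assoc, pullback.condition, pullback.condition]) ≫ act

namespace DescentDatum

variable {p : X ⟶ Y}

/-- Morphisms of descent data: morphisms over `X` that commute with the actions. -/
@[ext]
structure Hom (A B : DescentDatum p) where
  hom : A.obj ⟶ B.obj
  hom_str : hom ≫ B.str = A.str
  act_hom : A.act ≫ hom =
    pullback.lift (f := B.str ≫ p) (g := p)
      (pullback.fst (A.str ≫ p) p ≫ hom) (pullback.snd (A.str ≫ p) p)
      (by rw [Category.assoc, reassoc_of% hom_str, pullback.condition]) ≫ B.act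

/-- The category `Desc(p)` of descent data for `p`. -/
instance : Category (DescentDatum p) where
  Hom := Hom
  id A :=
    { hom := 𝟙 A.obj
      hom_str := by simp
      act_hom := by
        have h : pullback.lift (f := A.str ≫ p) (g := p)
            (pullback.fst (A.str ≫ p) p ≫ 𝟙 A.obj) (pullback.snd (A.str ≫ p) p)
            (by rw [Category.comp_id, pullback.condition]) = 𝟙 _ := by
          apply pullback.hom_ext <;> simp
        rw [h]
        simp }
  comp {A B D} f g :=
    { hom := f.hom ≫ g.hom
      hom_str := by rw [Category.assoc, g.hom_str, f.hom_str]
      act_hom := by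
        rw [reassoc_of% f.act_hom, g.act_hom, ← Category.assoc]
        congr 1
        apply pullback.hom_ext <;>
          simp [pullback.lift_fst, pullback.lift_snd, pullback.lift_fst_assoc] }
  id_comp f := Hom.ext (Category.id_comp _)
  comp_id f := Hom.ext (Category.comp_id _)
  assoc f g h := Hom.ext (Category.assoc _ _ _)

@[ext]
lemma hom_ext {A B : DescentDatum p} {f g : A ⟶ B}
    (h : Hom.hom f = Hom.hom g) : f = g :=
  Hom.ext h

@[simp]
lemma id_hom (A : DescentDatum p) : Hom.hom (𝟙 A) = 𝟙 A.obj := rfl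

@[simp]
lemma comp_hom {A B D : DescentDatum p} (f : A ⟶ B) (g : B ⟶ D) :
    Hom.hom (f ≫ g) = Hom.hom f ≫ Hom.hom g := rfl

end DescentDatum

/-- The canonical descent data on the pullback `Z ×_Y X ⟶ X` of `g : Z ⟶ Y` along `p`, with the
action `((z, x), x') ↦ (z, x')`. -/
noncomputable def canonicalDescentDatum (p : X ⟶ Y) {Z : C} (g : Z ⟶ Y) : DescentDatum p where
  obj := pullback g p
  str := pullback.snd g p
  act := pullback.lift (pullback.fst (pullback.snd g p ≫ p) p ≫ pullback.fst g p)
    (pullback.snd (pullback.snd g p ≫ p) p)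
    (by rw [Category.assoc, pullback.condition, pullback.condition])
  act_str := pullback.lift_snd _ _ _
  act_unit := by
    apply pullback.hom_ext <;>
      simp [pullback.lift_fst, pullback.lift_snd, pullback.lift_fst_assoc]
  act_assoc := by
    apply pullback.hom_ext <;>
      simp [pullback.lift_fst, pullback.lift_snd, pullback.lift_fst_assoc]

lemma canonicalDescentDatum_map_aux (p : X ⟶ Y) {Z Z' : C} {g : Z ⟶ Y} {g' : Z' ⟶ Y} (f : Z ⟶ Z')
    (k : pullback g p ⟶ pullback g' p) (hf : k ≫ pullback.fst g' p = pullback.fst g p ≫ f)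
    (hs : k ≫ pullback.snd g' p = pullback.snd g p) :
    pullback.lift (pullback.fst (pullback.snd g p ≫ p) p ≫ pullback.fst g p)
        (pullback.snd (pullback.snd g p ≫ p) p)
        (by rw [Category.assoc, pullback.condition, pullback.condition]) ≫ k =
      pullback.lift (f := pullback.snd g' p ≫ p) (g := p)
          (pullback.fst (pullback.snd g p ≫ p) p ≫ k) (pullback.snd (pullback.snd g p ≫ p) p)
          (by rw [Category.assoc, reassoc_of% hs, pullback.condition]) ≫
        pullback.lift (pullback.fst (pullback.snd g' p ≫ p) p ≫ pullback.fst g' p)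
          (pullback.snd (pullback.snd g' p ≫ p) p)
          (by rw [Category.assoc, pullback.condition, pullback.condition]) := by
  apply pullback.hom_ext
  · simp [pullback.lift_fst, pullback.lift_fst_assoc, hf]
  · simp [pullback.lift_snd, hs]

/-- The comparison functor from `C / Y` to the category of descent data for `p : X ⟶ Y`, given by
pulling back along `p`. -/
noncomputable def descentComparison (p : X ⟶ Y) : Over Y ⥤ DescentDatum p where
  obj Z := canonicalDescentDatum p Z.hom
  map {Z Z'} f :=
    { hom := pullback.lift (pullback.fst Z.hom p ≫ f.left) (pullback.snd Z.hom p)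
        ((Category.assoc _ _ _).trans ((congrArg _ (Over.w f)).trans pullback.condition))
      hom_str := pullback.lift_snd _ _ _
      act_hom := canonicalDescentDatum_map_aux p f.left _
        (pullback.lift_fst _ _ _) (pullback.lift_snd _ _ _) }
  map_id Z := DescentDatum.hom_ext (pullback.hom_ext
    ((pullback.lift_fst _ _ _).trans
      ((Category.comp_id _).trans (Category.id_comp (pullback.fst Z.hom p)).symm))
    ((pullback.lift_snd _ _ _).trans (Category.id_comp (pullback.snd Z.hom p)).symm))
  map_comp {Z₁ Z₂ Z₃} f g := DescentDatum.hom_ext (pullback.hom_ext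
    ((pullback.lift_fst _ _ _).trans (by
      rw [Over.comp_left, DescentDatum.comp_hom]
      exact ((Category.assoc _ _ _).trans ((congrArg _ (pullback.lift_fst _ _ _)).trans
        ((Category.assoc _ _ _).symm.trans ((congrArg (· ≫ g.left)
          (pullback.lift_fst _ _ _)).trans (Category.assoc _ _ _))))).symm))
    ((pullback.lift_snd _ _ _).trans
      ((Category.assoc _ _ _).trans ((congrArg _ (pullback.lift_snd _ _ _)).trans
        (pullback.lift_snd _ _ _))).symm))

/-- `p` is effective for descent (an effective descent morphism). -/
def IsEffectiveDescent (p : X ⟶ Y) : Prop :=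
  (descentComparison p).IsEquivalence

/-- `p` is an almost descent morphism. -/
def IsAlmostDescent (p : X ⟶ Y) : Prop :=
  (descentComparison p).Faithful

end Descent

/-! ## Factorizations and joins -/

section Factorization

variable {V : Type u} [Category.{v} V]

/-- A factorization of `f` as a regular epimorphism `e` followed by a monomorphism `m`. -/
structure RegularEpiMonoFactorisation {X Y : V} (f : X ⟶ Y) extends MonoFactorisation f where
  isRegularEpi_e : IsRegularEpi e

variable [HasPullbacks V]

/-- For a family `m i : M i ⟶ Y`, the diagram formed by the objects `M i ×_Y M j` for all pairs
`(i, j)`, the objects `M i`, and the projections `M i ×_Y M j ⟶ M i` and `M i ×_Y M j ⟶ M j`. -/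
noncomputable def joinDiagram {ι : Type w} {Y : V} {M : ι → V} (m : ∀ i, M i ⟶ Y) :
    MultispanIndex (MultispanShape.prod ι) V where
  left a := pullback (m a.1) (m a.2)
  right i := M i
  fst a := pullback.fst (m a.1) (m a.2)
  snd a := pullback.snd (m a.1) (m a.2)

/-- The canonical cocone with vertex `Y` on `joinDiagram m`. -/
noncomputable def joinCocone {ι : Type w} {Y : V} {M : ι → V} (m : ∀ i, M i ⟶ Y) :
    Multicofork (joinDiagram m) :=
  Multicofork.ofπ (joinDiagram m) Y m (fun _ => pullback.condition)

/-- The join of the family of subobjects `m i : M i ⟶ Y`, that is, the colimit of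
`joinDiagram m`, exists and is (canonically isomorphic to) `Y`. -/
def JoinIs {ι : Type w} {Y : V} {M : ι → V} (m : ∀ i, M i ⟶ Y) : Prop :=
  Nonempty (IsColimit (joinCocone m))

/-- The join of the `m i : M i ⟶ Y` exists, is `Y`, and is stable under pullback along every
morphism `g : Z ⟶ Y`. -/
def StableJoinIs {ι : Type w} {Y : V} {M : ι → V} (m : ∀ i, M i ⟶ Y) : Prop :=
  JoinIs m ∧ ∀ ⦃Z : V⦄ (g : Z ⟶ Y), JoinIs (fun i => pullback.snd (m i) g)

end Factorization

/-! ## Categories enriched in a cartesian monoidal category -/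

/-- A (small) `V`-category, for `V` with its cartesian monoidal structure. -/
structure VCat (V : Type u) [Category.{v} V] [CartesianMonoidalCategory V] where
  carrier : Type w
  [str : EnrichedCategory V carrier]

namespace VCat

variable {V : Type u} [Category.{v} V] [CartesianMonoidalCategory V]

instance : CoeSort (VCat.{w} V) (Type w) := ⟨VCat.carrier⟩

instance (C : VCat.{w} V) : EnrichedCategory V C := C.str

/-- The category of `V`-categories and `V`-functors. -/
instance : Category (VCat.{w} V) where
  Hom C D := EnrichedFunctor V C D
  id C := EnrichedFunctor.id V C
  comp F G := EnrichedFunctor.comp V F G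
  id_comp F := EnrichedFunctor.ext V (fun _ => rfl)
    (fun x y => by simp [EnrichedFunctor.comp, EnrichedFunctor.id])
  comp_id F := EnrichedFunctor.ext V (fun _ => rfl)
    (fun x y => by simp [EnrichedFunctor.comp, EnrichedFunctor.id])
  assoc F G H := EnrichedFunctor.ext V (fun _ => rfl)
    (fun x y => by simp [EnrichedFunctor.comp])

/-- The hom-object `C(x, y)`. -/
abbrev hom (C : VCat.{w} V) (x y : C) : V := EnrichedCategory.Hom x y

/-- The action of a `V`-functor on objects. -/
abbrev onObj {C D : VCat.{w} V} (F : C ⟶ D) (x : C) : D := EnrichedFunctor.obj F x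

/-- The hom-morphism `C(x, y) ⟶ D(F x, F y)` of a `V`-functor. -/
abbrev onHom {C D : VCat.{w} V} (F : C ⟶ D) (x y : C) :
    C.hom x y ⟶ D.hom (onObj F x) (onObj F y) := EnrichedFunctor.map F x y

/-- The set `F^* y` of objects `x` with `F x = y`. -/
abbrev Fiber {C D : VCat.{w} V} (F : C ⟶ D) (y : D) : Type w := {x : C // onObj F x = y}

section Pullback

lemma eComp_eqToHom {D : Type w} [EnrichedCategory V D] {x y z x' y' z' : D}
    (hx : x = x') (hy : y = y') (hz : z = z') :
    (eqToHom (by rw [hx, hy]) ⊗ₘ eqToHom (by rw [hy, hz])) ≫ eComp V x' y' z' =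
      eComp V x y z ≫ eqToHom (by rw [hx, hz]) := by
  subst hx hy hz
  simp

lemma eId_eqToHom {D : Type w} [EnrichedCategory V D] {x x' : D} (hx : x = x') :
    eId V x ≫ eqToHom (by rw [hx]) = eId V x' := by
  subst hx
  simp

lemma id_comp_aux {D : Type w} [EnrichedCategory V D] {x y : D} {P Q : V} {i : 𝟙_ V ⟶ P}
    {m : P ⊗ Q ⟶ Q} {p : P ⟶ EnrichedCategory.Hom x x} {q : Q ⟶ EnrichedCategory.Hom x y}
    (hi : i ≫ p = eId V x) (hm : m ≫ q = (p ⊗ₘ q) ≫ eComp V x x y) :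
    ((λ_ Q).inv ≫ i ▷ Q ≫ m) ≫ q = 𝟙 Q ≫ q := by
  have h : i ▷ Q ≫ (p ⊗ₘ q) = 𝟙_ V ◁ q ≫ eId V x ▷ _ := by
    rw [MonoidalCategory.tensorHom_def, ← comp_whiskerRight_assoc, hi, whisker_exchange]
  rw [Category.assoc, Category.assoc, hm, reassoc_of% h, ← leftUnitor_inv_naturality_assoc,
    e_id_comp, Category.comp_id, Category.id_comp]

lemma comp_id_aux {D : Type w} [EnrichedCategory V D] {x y : D} {P Q : V} {i : 𝟙_ V ⟶ P}
    {m : Q ⊗ P ⟶ Q} {p : P ⟶ EnrichedCategory.Hom y y} {q : Q ⟶ EnrichedCategory.Hom x y}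
    (hi : i ≫ p = eId V y) (hm : m ≫ q = (q ⊗ₘ p) ≫ eComp V x y y) :
    ((ρ_ Q).inv ≫ Q ◁ i ≫ m) ≫ q = 𝟙 Q ≫ q := by
  have h : Q ◁ i ≫ (q ⊗ₘ p) = q ▷ 𝟙_ V ≫ _ ◁ eId V y := by
    rw [MonoidalCategory.tensorHom_def', ← MonoidalCategory.whiskerLeft_comp_assoc, hi, whisker_exchange]
  rw [Category.assoc, Category.assoc, hm, reassoc_of% h, ← rightUnitor_inv_naturality_assoc,
    e_comp_id, Category.comp_id, Category.id_comp]

lemma assoc_aux {D : Type w} [EnrichedCategory V D] {x y z t : D} {P Q R S T U : V}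
    {p : P ⟶ EnrichedCategory.Hom x y} {q : Q ⟶ EnrichedCategory.Hom y z}
    {r : R ⟶ EnrichedCategory.Hom z t} {s : S ⟶ EnrichedCategory.Hom x z}
    {k : T ⟶ EnrichedCategory.Hom y t} {l : U ⟶ EnrichedCategory.Hom x t}
    {m₁ : P ⊗ Q ⟶ S} {m₂ : S ⊗ R ⟶ U} {m₃ : Q ⊗ R ⟶ T} {m₄ : P ⊗ T ⟶ U}
    (h₁ : m₁ ≫ s = (p ⊗ₘ q) ≫ eComp V x y z) (h₂ : m₂ ≫ l = (s ⊗ₘ r) ≫ eComp V x z t)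
    (h₃ : m₃ ≫ k = (q ⊗ₘ r) ≫ eComp V y z t) (h₄ : m₄ ≫ l = (p ⊗ₘ k) ≫ eComp V x y t) :
    ((α_ P Q R).inv ≫ m₁ ▷ R ≫ m₂) ≫ l = (P ◁ m₃ ≫ m₄) ≫ l := by
  have e₁ : m₁ ▷ R ≫ (s ⊗ₘ r) = ((p ⊗ₘ q) ⊗ₘ r) ≫ eComp V x y z ▷ _ := by
    rw [← tensorHom_id, ← tensorHom_id, tensorHom_comp_tensorHom, tensorHom_comp_tensorHom, h₁,
      Category.id_comp, Category.comp_id]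
  have e₂ : P ◁ m₃ ≫ (p ⊗ₘ k) = (p ⊗ₘ (q ⊗ₘ r)) ≫ _ ◁ eComp V y z t := by
    rw [← id_tensorHom, ← id_tensorHom, tensorHom_comp_tensorHom, tensorHom_comp_tensorHom, h₃,
      Category.id_comp, Category.comp_id]
  rw [Category.assoc, Category.assoc, Category.assoc, h₂, h₄, reassoc_of% e₁, reassoc_of% e₂,
    ← associator_inv_naturality_assoc, e_assoc]

lemma lift_comp_aux {D : Type w} [EnrichedCategory V D] {x y z : D} {P Q R S T : V}
    {f : P ⟶ Q} {g : R ⟶ S} {m : Q ⊗ S ⟶ T} {p : Q ⟶ EnrichedCategory.Hom x y}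
    {q : S ⟶ EnrichedCategory.Hom y z} {r : T ⟶ EnrichedCategory.Hom x z}
    {f' : P ⟶ EnrichedCategory.Hom x y} {g' : R ⟶ EnrichedCategory.Hom y z}
    (hf : f ≫ p = f') (hg : g ≫ q = g') (hm : m ≫ r = (p ⊗ₘ q) ≫ eComp V x y z) :
    ((f ⊗ₘ g) ≫ m) ≫ r = (f' ⊗ₘ g') ≫ eComp V x y z := by
  rw [Category.assoc, hm, tensorHom_comp_tensorHom_assoc, hf, hg]

lemma onHom_congr {C D : VCat.{w} V} {H K : C ⟶ D} (h : H = K) (x y : C) :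
    onHom H x y = onHom K x y ≫ eqToHom (by rw [h]) := by
  subst h
  simp

variable {C D E : VCat.{w} V} (F : C ⟶ D) (G : E ⟶ D)

/-- The objects of the pullback of `V`-functors. -/
abbrev PullbackObj : Type w := {q : C × E // onObj F q.1 = onObj G q.2}

/-- `G` on hom-objects, with codomain transported along the equalities `F c = G e`. -/
def transportedHom (q r : PullbackObj F G) :
    E.hom q.1.2 r.1.2 ⟶ D.hom (onObj F q.1.1) (onObj F r.1.1) :=
  onHom G q.1.2 r.1.2 ≫ eqToHom (by rw [q.2, r.2])

lemma id_condition (q : PullbackObj F G) :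
    eId V q.1.1 ≫ onHom F q.1.1 q.1.1 = eId V q.1.2 ≫ transportedHom F G q q := by
  unfold transportedHom
  rw [EnrichedFunctor.map_id, EnrichedFunctor.map_id_assoc, eId_eqToHom q.2.symm]

/-- The action on objects of the induced `V`-functor to the pullback. -/
def liftObj {T : VCat.{w} V} {F : C ⟶ D} {G : E ⟶ D} (A : T ⟶ C) (B : T ⟶ E)
    (h : A ≫ F = B ≫ G) (t : T) : PullbackObj F G :=
  ⟨(onObj A t, onObj B t), congrArg (fun K : T ⟶ D => onObj K t) h⟩

lemma lift_condition {T : VCat.{w} V} {F : C ⟶ D} {G : E ⟶ D} (A : T ⟶ C) (B : T ⟶ E)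
    (h : A ≫ F = B ≫ G) (s t : T) : onHom A s t ≫ onHom F (onObj A s) (onObj A t) =
    onHom B s t ≫ transportedHom F G (liftObj A B h s) (liftObj A B h t) :=
  (onHom_congr h s t).trans (Category.assoc _ _ _)

variable [HasPullbacks V]

/-- The hom-objects of the pullback of `V`-functors. -/
noncomputable abbrev pullbackHom (q r : PullbackObj F G) : V :=
  pullback (onHom F q.1.1 r.1.1) (transportedHom F G q r)

lemma comp_condition (q r s : PullbackObj F G) :
    ((pullback.fst (onHom F q.1.1 r.1.1) (transportedHom F G q r) ⊗ₘ
        pullback.fst (onHom F r.1.1 s.1.1) (transportedHom F G r s)) ≫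
        eComp V q.1.1 r.1.1 s.1.1) ≫ onHom F q.1.1 s.1.1 =
      ((pullback.snd (onHom F q.1.1 r.1.1) (transportedHom F G q r) ⊗ₘ
        pullback.snd (onHom F r.1.1 s.1.1) (transportedHom F G r s)) ≫
        eComp V q.1.2 r.1.2 s.1.2) ≫ transportedHom F G q s := by
  have h : eComp V q.1.2 r.1.2 s.1.2 ≫ transportedHom F G q s =
      (transportedHom F G q r ⊗ₘ transportedHom F G r s) ≫ eComp V _ _ _ := by
    unfold transportedHom
    rw [EnrichedFunctor.map_comp_assoc, ← eComp_eqToHom q.2.symm r.2.symm s.2.symm,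
      MonoidalCategory.tensorHom_comp_tensorHom_assoc]
  rw [Category.assoc, EnrichedFunctor.map_comp, Category.assoc, h,
    MonoidalCategory.tensorHom_comp_tensorHom_assoc,
    MonoidalCategory.tensorHom_comp_tensorHom_assoc, pullback.condition, pullback.condition]

/-- The pullback of `V`-functors, with hom-objects computed as pullbacks in `V`. -/
noncomputable def pullbackCat : VCat.{w} V where
  carrier := PullbackObj F G
  str :=
    { Hom := pullbackHom F G
      id := fun q => pullback.lift (eId V q.1.1) (eId V q.1.2) (id_condition F G q)
      comp := fun q r s => pullback.lift _ _ (comp_condition F G q r s)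
      id_comp := fun _ _ => pullback.hom_ext
        (id_comp_aux (pullback.lift_fst _ _ _) (pullback.lift_fst _ _ _))
        (id_comp_aux (pullback.lift_snd _ _ _) (pullback.lift_snd _ _ _))
      comp_id := fun _ _ => pullback.hom_ext
        (comp_id_aux (pullback.lift_fst _ _ _) (pullback.lift_fst _ _ _))
        (comp_id_aux (pullback.lift_snd _ _ _) (pullback.lift_snd _ _ _))
      assoc := fun _ _ _ _ => pullback.hom_ext
        (assoc_aux (pullback.lift_fst _ _ _) (pullback.lift_fst _ _ _)
          (pullback.lift_fst _ _ _) (pullback.lift_fst _ _ _))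
        (assoc_aux (pullback.lift_snd _ _ _) (pullback.lift_snd _ _ _)
          (pullback.lift_snd _ _ _) (pullback.lift_snd _ _ _)) }

/-- The first projection of the pullback of `V`-functors. -/
noncomputable def pullbackFst : pullbackCat F G ⟶ C where
  obj := fun q : PullbackObj F G => q.1.1
  map := fun q r : PullbackObj F G => pullback.fst (onHom F q.1.1 r.1.1) (transportedHom F G q r)
  map_id := fun _ => pullback.lift_fst _ _ _
  map_comp := fun _ _ _ => pullback.lift_fst _ _ _

/-- The second projection of the pullback of `V`-functors. -/
noncomputable def pullbackSnd : pullbackCat F G ⟶ E where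
  obj := fun q : PullbackObj F G => q.1.2
  map := fun q r : PullbackObj F G => pullback.snd (onHom F q.1.1 r.1.1) (transportedHom F G q r)
  map_id := fun _ => pullback.lift_snd _ _ _
  map_comp := fun _ _ _ => pullback.lift_snd _ _ _

lemma pullback_condition : pullbackFst F G ≫ F = pullbackSnd F G ≫ G :=
  EnrichedFunctor.ext V (fun q : PullbackObj F G => q.2) (fun q r : PullbackObj F G => by
    have h : pullback.fst (onHom F q.1.1 r.1.1) (transportedHom F G q r) ≫ onHom F q.1.1 r.1.1 =
        pullback.snd (onHom F q.1.1 r.1.1) (transportedHom F G q r) ≫ onHom G q.1.2 r.1.2 ≫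
          eqToHom (by rw [q.2, r.2]) := pullback.condition
    have h' := congrArg (· ≫ eqToHom (show D.hom (onObj F q.1.1) (onObj F r.1.1) =
      D.hom (onObj G q.1.2) (onObj G r.1.2) by rw [q.2, r.2])) h
    refine h'.trans ?_
    simp only [Category.assoc, eqToHom_trans, eqToHom_refl, Category.comp_id]
    rfl)

/-- The `V`-functor to the pullback induced by a commutative square. -/
noncomputable def pullbackLift {T : VCat.{w} V} {F : C ⟶ D} {G : E ⟶ D} (A : T ⟶ C) (B : T ⟶ E)
    (h : A ≫ F = B ≫ G) : T ⟶ pullbackCat F G where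
  obj := liftObj A B h
  map := fun s t => pullback.lift (onHom A s t) (onHom B s t) (lift_condition A B h s t)
  map_id := fun t => pullback.hom_ext
    ((Category.assoc _ _ _).trans ((congrArg _ (pullback.lift_fst _ _ _)).trans
      ((EnrichedFunctor.map_id A t).trans (pullback.lift_fst _ _ _).symm)))
    ((Category.assoc _ _ _).trans ((congrArg _ (pullback.lift_snd _ _ _)).trans
      ((EnrichedFunctor.map_id B t).trans (pullback.lift_snd _ _ _).symm)))
  map_comp := fun r s t => pullback.hom_ext
    ((Category.assoc _ _ _).trans ((congrArg _ (pullback.lift_fst _ _ _)).trans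
      ((EnrichedFunctor.map_comp A r s t).trans (lift_comp_aux (pullback.lift_fst _ _ _)
        (pullback.lift_fst _ _ _) (pullback.lift_fst _ _ _)).symm)))
    ((Category.assoc _ _ _).trans ((congrArg _ (pullback.lift_snd _ _ _)).trans
      ((EnrichedFunctor.map_comp B r s t).trans (lift_comp_aux (pullback.lift_snd _ _ _)
        (pullback.lift_snd _ _ _) (pullback.lift_snd _ _ _)).symm)))

lemma eqToHom_pullback_fst {q q' r r' : PullbackObj F G} (hq : q = q') (hr : r = r') :
    eqToHom (show pullbackHom F G q r = pullbackHom F G q' r' by rw [hq, hr]) ≫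
        pullback.fst (onHom F q'.1.1 r'.1.1) (transportedHom F G q' r') =
      pullback.fst (onHom F q.1.1 r.1.1) (transportedHom F G q r) ≫
        eqToHom (show C.hom q.1.1 r.1.1 = C.hom q'.1.1 r'.1.1 by rw [hq, hr]) := by
  subst hq hr
  simp

lemma eqToHom_pullback_snd {q q' r r' : PullbackObj F G} (hq : q = q') (hr : r = r') :
    eqToHom (show pullbackHom F G q r = pullbackHom F G q' r' by rw [hq, hr]) ≫
        pullback.snd (onHom F q'.1.1 r'.1.1) (transportedHom F G q' r') =
      pullback.snd (onHom F q.1.1 r.1.1) (transportedHom F G q r) ≫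
        eqToHom (show E.hom q.1.2 r.1.2 = E.hom q'.1.2 r'.1.2 by rw [hq, hr]) := by
  subst hq hr
  simp

lemma pullbackCat_hom_ext {T : VCat.{w} V} {m n : T ⟶ pullbackCat F G}
    (h₁ : m ≫ pullbackFst F G = n ≫ pullbackFst F G)
    (h₂ : m ≫ pullbackSnd F G = n ≫ pullbackSnd F G) : m = n := by
  have ho : ∀ t : T, onObj m t = onObj n t := fun t =>
    Subtype.ext (Prod.ext (congrArg (fun K : T ⟶ C => onObj K t) h₁)
      (congrArg (fun K : T ⟶ E => onObj K t) h₂))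
  refine EnrichedFunctor.ext V ho (fun s t => pullback.hom_ext ?_ ?_)
  · refine (Category.assoc _ _ _).trans
      ((congrArg _ (eqToHom_pullback_fst F G (ho s) (ho t))).trans ?_)
    have h := onHom_congr h₁ s t
    refine (Category.assoc _ _ _).symm.trans ((congrArg (· ≫ eqToHom _) h).trans ?_)
    exact (Category.assoc _ _ _).trans ((congrArg _ (eqToHom_trans _ _)).trans
      (Category.comp_id _))
  · refine (Category.assoc _ _ _).trans
      ((congrArg _ (eqToHom_pullback_snd F G (ho s) (ho t))).trans ?_)
    have h := onHom_congr h₂ s t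
    refine (Category.assoc _ _ _).symm.trans ((congrArg (· ≫ eqToHom _) h).trans ?_)
    exact (Category.assoc _ _ _).trans ((congrArg _ (eqToHom_trans _ _)).trans
      (Category.comp_id _))

lemma pullbackLift_fst {T : VCat.{w} V} {F : C ⟶ D} {G : E ⟶ D} (A : T ⟶ C) (B : T ⟶ E)
    (h : A ≫ F = B ≫ G) : pullbackLift A B h ≫ pullbackFst F G = A :=
  EnrichedFunctor.ext V (fun _ => rfl)
    (fun _ _ => (Category.comp_id _).trans (pullback.lift_fst _ _ _))

lemma pullbackLift_snd {T : VCat.{w} V} {F : C ⟶ D} {G : E ⟶ D} (A : T ⟶ C) (B : T ⟶ E)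
    (h : A ≫ F = B ≫ G) : pullbackLift A B h ≫ pullbackSnd F G = B :=
  EnrichedFunctor.ext V (fun _ => rfl)
    (fun _ _ => (Category.comp_id _).trans (pullback.lift_snd _ _ _))

lemma isPullback : IsPullback (pullbackFst F G) (pullbackSnd F G) F G where
  w := pullback_condition F G
  isLimit' := ⟨PullbackCone.IsLimit.mk _
    (fun s => pullbackLift s.fst s.snd s.condition)
    (fun s => pullbackLift_fst s.fst s.snd s.condition)
    (fun s => pullbackLift_snd s.fst s.snd s.condition)
    (fun s _ h₁ h₂ => pullbackCat_hom_ext F G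
      (h₁.trans (pullbackLift_fst s.fst s.snd s.condition).symm)
      (h₂.trans (pullbackLift_snd s.fst s.snd s.condition).symm))⟩

/-- The category of `V`-categories has pullbacks if `V` has. -/
instance : HasPullbacks (VCat.{w} V) :=
  have : ∀ {X Y Z : VCat.{w} V} {f : X ⟶ Z} {g : Y ⟶ Z}, HasLimit (cospan f g) :=
    fun {_ _ _ f g} => (isPullback f g).hasPullback
  hasPullbacks_of_hasLimit_cospan _

end Pullback

/-! ### Families of morphisms indexed by fibers

In the following definitions the `eqToHom`s identify `D(F x₀, F x₁)` with `D(y₀, y₁)` when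
`F x₀ = y₀` and `F x₁ = y₁`, and similarly for products. -/

section Families

variable {C D : VCat.{w} V} (F : C ⟶ D)

/-- The object `C(x₁, x₂) × C(x₀, x₁)`. -/
abbrev homPair (C : VCat.{w} V) (x₀ x₁ x₂ : C) : V := C.hom x₁ x₂ ⊗ C.hom x₀ x₁

/-- The object `C(x₂, x₃) × C(x₁, x₂) × C(x₀, x₁)`. -/
abbrev homTriple (C : VCat.{w} V) (x₀ x₁ x₂ x₃ : C) : V :=
  C.hom x₂ x₃ ⊗ C.hom x₁ x₂ ⊗ C.hom x₀ x₁

/-- The morphism `C(x₁, x₂) × C(x₀, x₁) ⟶ D(F x₁, F x₂) × D(F x₀, F x₁)`. -/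
abbrev onHomPair (x₀ x₁ x₂ : C) :
    C.homPair x₀ x₁ x₂ ⟶ D.homPair (onObj F x₀) (onObj F x₁) (onObj F x₂) :=
  onHom F x₁ x₂ ⊗ₘ onHom F x₀ x₁

/-- The morphism from `C(x₂, x₃) × C(x₁, x₂) × C(x₀, x₁)` to
`D(F x₂, F x₃) × D(F x₁, F x₂) × D(F x₀, F x₁)`. -/
abbrev onHomTriple (x₀ x₁ x₂ x₃ : C) :
    C.homTriple x₀ x₁ x₂ x₃ ⟶
      D.homTriple (onObj F x₀) (onObj F x₁) (onObj F x₂) (onObj F x₃) :=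
  onHom F x₂ x₃ ⊗ₘ onHom F x₁ x₂ ⊗ₘ onHom F x₀ x₁

/-- The family `(M x₀ x₁ ⟶ D(y₀, y₁))`, over `x₀` in `F^* y₀` and `x₁` in `F^* y₁`, obtained
from morphisms `M x₀ x₁ ⟶ D(F x₀, F x₁)`. -/
def overHom {M : C → C → V} (J : ∀ x₀ x₁, M x₀ x₁ ⟶ D.hom (onObj F x₀) (onObj F x₁))
    (y₀ y₁ : D) (q : Fiber F y₀ × Fiber F y₁) : M q.1 q.2 ⟶ D.hom y₀ y₁ :=
  J q.1 q.2 ≫ eqToHom (by rw [q.1.2, q.2.2])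

/-- The family `(M x₀ x₁ x₂ ⟶ D(y₁, y₂) × D(y₀, y₁))`, over `xᵢ` in `F^* yᵢ`. -/
def overHomPair {M : C → C → C → V}
    (J : ∀ x₀ x₁ x₂, M x₀ x₁ x₂ ⟶ D.homPair (onObj F x₀) (onObj F x₁) (onObj F x₂))
    (y₀ y₁ y₂ : D) (q : Fiber F y₀ × Fiber F y₁ × Fiber F y₂) :
    M q.1 q.2.1 q.2.2 ⟶ D.homPair y₀ y₁ y₂ :=
  J q.1 q.2.1 q.2.2 ≫ eqToHom (by rw [q.1.2, q.2.1.2, q.2.2.2])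

/-- The family `(M x₀ x₁ x₂ x₃ ⟶ D(y₂, y₃) × D(y₁, y₂) × D(y₀, y₁))`, over `xᵢ` in
`F^* yᵢ`. -/
def overHomTriple {M : C → C → C → C → V}
    (J : ∀ x₀ x₁ x₂ x₃,
      M x₀ x₁ x₂ x₃ ⟶ D.homTriple (onObj F x₀) (onObj F x₁) (onObj F x₂) (onObj F x₃))
    (y₀ y₁ y₂ y₃ : D) (q : Fiber F y₀ × Fiber F y₁ × Fiber F y₂ × Fiber F y₃) :
    M q.1 q.2.1 q.2.2.1 q.2.2.2 ⟶ D.homTriple y₀ y₁ y₂ y₃ :=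
  J q.1 q.2.1 q.2.2.1 q.2.2.2 ≫ eqToHom (by rw [q.1.2, q.2.1.2, q.2.2.1.2, q.2.2.2.2])

end Families

end VCat

/-- A family `m i : M i ⟶ Y` in `V`, regarded as a morphism `(M i)ᵢ ⟶ Y` of `Fam(V)`, the free
coproduct completion of `V`. -/
abbrev famHom {V : Type u} [Category.{v} V] {ι : Type w} {Y : V} {M : ι → V} (m : ∀ i, M i ⟶ Y) :
    FormalCoproduct.mk ι M ⟶ (FormalCoproduct.incl.{w} V).obj Y :=
  FormalCoproduct.homOfPiHom Y M m

/-! A descent datum for `F` is a `V`-category `W` over `C` with an action of the kernel pair of `F`.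
It has to be realized as the pullback along `F` of some `E` over `D`. The objects of `E` are the
orbits of the action on the objects of `W`: an orbit over `y` contains exactly one object over each
`x` in the fibre of `F` at `y`.

For orbits `e₀`, `e₁` over `y₀`, `y₁`, the hom-objects `W(w₀, w₁)` lie over the family of the `C(x₀,
x₁) ⟶ D(y₀, y₁)`, and the kernel pair of this family acts on them. Conditions 1 and 2 allow them to
descend in two stages, along the regular epimorphisms `P` and then along the family of images
(`HasDescent.hasFamilyDescent`, `HasFamilyDescent.regularEpi_comp`). The result is an object over
`D(y₀, y₁)` whose pullbacks are the `W(w₀, w₁)`; these objects are the hom-objects of `E`.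

The structure of `E` is forced. Identities come from any representative. Composition descends from
`W` because, by condition 3, the family of pairs of homs is universally effective-epimorphic.
Associativity can be tested on triples, which are universally epimorphic by condition 4, and the
unit laws on homs, which are covering by condition 2. All of these families for `W ⟶ E` are
pullbacks of those for `F`, so stability under pullback is what makes the argument work
(`VCat.HomPullback.exists_isPullback`).

The same families give descent of morphisms: a `V`-functor that is surjective on objects, with
covering homs and pairs, is an effective epimorphism (`VCat.existsUnique_desc`), and these
properties pass to every pullback of `F`. The criterion `isEffectiveDescent_of` joins the two
halves.

Hypotheses in `Fam(V)` and stable joins are turned into statements about families in `V` by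
`IsEffectiveDescent.isCovering`, `IsAlmostDescent.isUnivEpi` and `StableJoinIs.isCovering`. Actions
are handled as natural operations on generalized elements, so that iterated pullbacks seldom have to
be written out. -/

/-! ## Descent in terms of generalized elements -/

section DescentPoints

variable {C : Type u} [Category.{v} C] {X Y : C}

/-- An action of the kernel pair of `p : X ⟶ Y` on `s : A ⟶ X`, given on generalized elements. -/
structure PointAction (p : X ⟶ Y) {A : C} (s : A ⟶ X) where
  act : ∀ {T : C} (a : T ⟶ A) (x : T ⟶ X), a ≫ s ≫ p = x ≫ p → (T ⟶ A)
  comp_act : ∀ {T T' : C} (t : T' ⟶ T) (a : T ⟶ A) (x : T ⟶ X) (h : a ≫ s ≫ p = x ≫ p)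
    (h' : (t ≫ a) ≫ s ≫ p = (t ≫ x) ≫ p), t ≫ act a x h = act (t ≫ a) (t ≫ x) h'
  act_str : ∀ {T : C} (a : T ⟶ A) (x : T ⟶ X) (h : a ≫ s ≫ p = x ≫ p), act a x h ≫ s = x
  act_unit : ∀ {T : C} (a : T ⟶ A) (x : T ⟶ X) (h : a ≫ s ≫ p = x ≫ p), a ≫ s = x →
    act a x h = a
  act_act : ∀ {T : C} (a : T ⟶ A) (x x' : T ⟶ X) (h : a ≫ s ≫ p = x ≫ p)
    (h' : act a x h ≫ s ≫ p = x' ≫ p) (h'' : a ≫ s ≫ p = x' ≫ p),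
    act (act a x h) x' h' = act a x' h''

lemma PointAction.comp_act_eq {p : X ⟶ Y} {A : C} {s : A ⟶ X} (α : PointAction p s) {T T' : C}
    (t : T' ⟶ T) {a : T ⟶ A} {x : T ⟶ X} (h : a ≫ s ≫ p = x ≫ p) {a' : T' ⟶ A} {x' : T' ⟶ X}
    (ha : t ≫ a = a') (hx : t ≫ x = x') (h' : a' ≫ s ≫ p = x' ≫ p) :
    t ≫ α.act a x h = α.act a' x' h' := by
  subst ha hx
  exact α.comp_act t a x h h'

/-- Every action of the kernel pair of `p` comes from an object over the codomain of `p`. -/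
def HasDescent (p : X ⟶ Y) : Prop :=
  ∀ {A : C} (s : A ⟶ X) (α : PointAction p s), ∃ (E : C) (ε : E ⟶ Y) (k : A ⟶ E),
    IsPullback k s ε p ∧
      ∀ {T : C} (a : T ⟶ A) (x : T ⟶ X) (h : a ≫ s ≫ p = x ≫ p), α.act a x h ≫ k = a ≫ k

/-- Actions for `i ≫ p`, with `i` an isomorphism, are actions for `p`. -/
noncomputable def PointAction.ofIsoComp {X' : C} {i : X' ⟶ X} [IsIso i] {p : X ⟶ Y} {A : C} {s : A ⟶ X'}
    (α : PointAction (i ≫ p) s) : PointAction p (s ≫ i) where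
  act a x h := α.act a (x ≫ inv i) (by simpa using h)
  comp_act t a x h h' := by
    rw [α.comp_act t a (x ≫ inv i) _ (by simpa using h')]
    simp only [Category.assoc]
  act_str a x h := by rw [← Category.assoc, α.act_str]; simp
  act_unit a x h hx := α.act_unit _ _ _ (by simp [← hx])
  act_act a x x' h h' h'' := α.act_act _ _ _ _ _ _

lemma HasDescent.iso_comp {X' : C} {i : X' ⟶ X} [IsIso i] {p : X ⟶ Y} (hp : HasDescent p) :
    HasDescent (i ≫ p) := by
  intro A s α
  obtain ⟨E, ε, k, hk, h⟩ := hp (s ≫ i) α.ofIsoComp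
  refine ⟨E, ε, k, ?_, fun a x hx => ?_⟩
  · exact IsPullback.of_iso hk (Iso.refl _) (Iso.refl _) (asIso (inv i)) (Iso.refl _)
      (by simp) (by simp) (by simp) (by simp)
  · have := h a (x ≫ i) (by simpa using hx)
    simpa [PointAction.ofIsoComp] using this

variable [HasPullbacks C]

/-- The descent datum defined by an action on generalized elements. -/
noncomputable def PointAction.datum {p : X ⟶ Y} {A : C} {s : A ⟶ X} (α : PointAction p s) :
    DescentDatum p where
  obj := A
  str := s
  act := α.act (pullback.fst (s ≫ p) p) (pullback.snd (s ≫ p) p) pullback.condition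
  act_str := α.act_str _ _ _
  act_unit := by
    rw [α.comp_act_eq _ _ (pullback.lift_fst _ _ _) (pullback.lift_snd _ _ _) (by simp)]
    exact α.act_unit _ _ _ (Category.id_comp s)
  act_assoc := by
    have h₁ : pullback.fst (pullback.snd (s ≫ p) p ≫ p) p ≫
        α.act (pullback.fst (s ≫ p) p) (pullback.snd (s ≫ p) p) pullback.condition =
        α.act (pullback.fst (pullback.snd (s ≫ p) p ≫ p) p ≫ pullback.fst (s ≫ p) p)
          (pullback.fst (pullback.snd (s ≫ p) p ≫ p) p ≫ pullback.snd (s ≫ p) p)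
          (by rw [Category.assoc, Category.assoc, pullback.condition]) :=
      α.comp_act _ _ _ _ _
    have h₂ : (pullback.fst (pullback.snd (s ≫ p) p ≫ p) p ≫ pullback.snd (s ≫ p) p) ≫ p =
        pullback.snd (pullback.snd (s ≫ p) p ≫ p) p ≫ p := by
      rw [Category.assoc, pullback.condition]
    have h₃ : (pullback.fst (pullback.snd (s ≫ p) p ≫ p) p ≫ pullback.fst (s ≫ p) p) ≫ s ≫ p =
        pullback.snd (pullback.snd (s ≫ p) p ≫ p) p ≫ p := by
      rw [← h₂, Category.assoc, Category.assoc, pullback.condition]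
    rw [α.comp_act_eq _ _ ((pullback.lift_fst _ _ _).trans h₁) (pullback.lift_snd _ _ _)
        (by rw [← Category.assoc, α.act_str, h₂]),
      α.comp_act_eq _ _ (pullback.lift_fst _ _ _) (pullback.lift_snd _ _ _) h₃]
    exact α.act_act _ _ _ _ _ _

/-- Essential surjectivity supplies an object `Z` over `Y` whose canonical datum is isomorphic to
the given one. The canonical action fixes the `Z`-component, so the induced map to `Z` is invariant.
-/
lemma IsEffectiveDescent.hasDescent {p : X ⟶ Y} (hp : IsEffectiveDescent p) : HasDescent p := by
  intro A s α
  have := hp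
  unfold IsEffectiveDescent at this
  obtain ⟨Z, ⟨e⟩⟩ := Functor.EssSurj.mem_essImage (F := descentComparison p) α.datum
  let j : A ≅ pullback Z.hom p :=
    { hom := DescentDatum.Hom.hom e.inv
      inv := DescentDatum.Hom.hom e.hom
      hom_inv_id := congrArg DescentDatum.Hom.hom e.inv_hom_id
      inv_hom_id := congrArg DescentDatum.Hom.hom e.hom_inv_id }
  have hj : j.hom ≫ pullback.snd Z.hom p = s := DescentDatum.Hom.hom_str e.inv
  refine ⟨Z.left, Z.hom, j.hom ≫ pullback.fst Z.hom p, ?_, fun a x h => ?_⟩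
  · exact IsPullback.of_iso (IsPullback.of_hasPullback Z.hom p) j.symm (Iso.refl _) (Iso.refl _)
      (Iso.refl _) (by simp) (by simp [← hj]) (by simp) (by simp)
  · have h₁ : α.act (pullback.fst (s ≫ p) p) (pullback.snd (s ≫ p) p) pullback.condition ≫ j.hom =
        pullback.lift (f := pullback.snd Z.hom p ≫ p) (g := p)
          (pullback.fst (s ≫ p) p ≫ j.hom) (pullback.snd (s ≫ p) p)
          (by rw [Category.assoc, reassoc_of% hj, pullback.condition]) ≫
        pullback.lift (pullback.fst (pullback.snd Z.hom p ≫ p) p ≫ pullback.fst Z.hom p)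
          (pullback.snd (pullback.snd Z.hom p ≫ p) p)
          (by rw [Category.assoc, pullback.condition, pullback.condition]) :=
      DescentDatum.Hom.act_hom e.inv
    have h₂ := congrArg (fun t => pullback.lift a x h ≫ t ≫ pullback.fst Z.hom p) h₁
    have h₃ := α.comp_act (pullback.lift a x h) (pullback.fst (s ≫ p) p) (pullback.snd (s ≫ p) p)
      pullback.condition
      (by rw [pullback.lift_fst, pullback.lift_snd, h])
    simp only [pullback.lift_fst, pullback.lift_snd] at h₃
    simp only [Category.assoc, pullback.lift_fst, pullback.lift_fst_assoc] at h₂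
    rw [reassoc_of% h₃] at h₂
    exact h₂

lemma IsEffectiveDescent.isAlmostDescent {p : X ⟶ Y} (hp : IsEffectiveDescent p) :
    IsAlmostDescent p :=
  hp.faithful

/-- For an almost descent morphism `p`, pulling back along `p` is faithful. -/
lemma IsAlmostDescent.hom_ext {p : X ⟶ Y} (hp : IsAlmostDescent p) {Z Z' : C} {g : Z ⟶ Y}
    {g' : Z' ⟶ Y} {d d' : Z ⟶ Z'} (hd : d ≫ g' = g) (hd' : d' ≫ g' = g)
    (h : pullback.fst g p ≫ d = pullback.fst g p ≫ d') : d = d' := by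
  have := hp
  unfold IsAlmostDescent at this
  let D : Over.mk g ⟶ Over.mk g' := Over.homMk d hd
  let D' : Over.mk g ⟶ Over.mk g' := Over.homMk d' hd'
  have e : D = D' := by
    apply (descentComparison p).map_injective
    apply DescentDatum.hom_ext
    apply pullback.hom_ext
    · exact (pullback.lift_fst _ _ _).trans (h.trans (pullback.lift_fst _ _ _).symm)
    · exact (pullback.lift_snd _ _ _).trans (pullback.lift_snd _ _ _).symm
  exact congrArg (fun t : Over.mk g ⟶ Over.mk g' => t.left) e

lemma IsAlmostDescent.hom_ext_of_isPullback {p : X ⟶ Y} (hp : IsAlmostDescent p) {P Z Z' : C}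
    {q : P ⟶ Z} {b : P ⟶ X} {g : Z ⟶ Y} (hP : IsPullback q b g p) {g' : Z' ⟶ Y} {d d' : Z ⟶ Z'}
    (hd : d ≫ g' = g) (hd' : d' ≫ g' = g) (h : q ≫ d = q ≫ d') : d = d' := by
  refine hp.hom_ext hd hd' ?_
  rw [← hP.isoPullback_inv_fst, Category.assoc, Category.assoc, h]

/-- For an effective descent morphism `p`, morphisms over `Y` descend along pullbacks of `p`. -/
lemma IsEffectiveDescent.exists_desc {p : X ⟶ Y} (hp : IsEffectiveDescent p) {Z Z' : C} {g : Z ⟶ Y}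
    {g' : Z' ⟶ Y} (e : pullback g p ⟶ Z') (he : e ≫ g' = pullback.fst g p ≫ g)
    (h : ∀ {U : C} (a b : U ⟶ pullback g p), a ≫ pullback.fst g p = b ≫ pullback.fst g p →
      a ≫ e = b ≫ e) : ∃ d : Z ⟶ Z', d ≫ g' = g ∧ pullback.fst g p ≫ d = e := by
  have := hp
  unfold IsEffectiveDescent at this
  let k : pullback g p ⟶ pullback g' p :=
    pullback.lift e (pullback.snd g p) (he.trans pullback.condition)
  let K : (descentComparison p).obj (Over.mk g) ⟶ (descentComparison p).obj (Over.mk g') :=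
    { hom := k
      hom_str := pullback.lift_snd _ _ _
      act_hom := by
        apply pullback.hom_ext
        -- On the `Z'`-component the two sides are `e` at `(z, x')` and `e` at `(z, x)`. These
        -- points share their `Z`-component, so `h` applies.
        · refine (Category.assoc _ _ _).trans ((congrArg _ (pullback.lift_fst _ _ _)).trans ?_)
          refine Eq.trans ?_ (Category.assoc _ _ _).symm
          refine Eq.trans ?_ (congrArg _ (pullback.lift_fst _ _ _)).symm
          refine Eq.trans ?_ (pullback.lift_fst_assoc _ _ _ _).symm
          refine Eq.trans ?_ (Category.assoc _ _ _).symm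
          refine Eq.trans ?_ (congrArg _ (pullback.lift_fst _ _ _)).symm
          exact h _ _ (pullback.lift_fst _ _ _)
        · refine (Category.assoc _ _ _).trans ((congrArg _ (pullback.lift_snd _ _ _)).trans ?_)
          refine Eq.trans ?_ (Category.assoc _ _ _).symm
          refine Eq.trans ?_ (congrArg _ (pullback.lift_snd _ _ _)).symm
          exact (pullback.lift_snd _ _ _).trans (pullback.lift_snd _ _ _).symm }
  obtain ⟨D, hD⟩ := (descentComparison p).map_surjective K
  refine ⟨D.left, Over.w D, ?_⟩
  have h₁ := congrArg (fun t => DescentDatum.Hom.hom t ≫ pullback.fst g' p) hD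
  exact (pullback.lift_fst _ _ _).symm.trans (h₁.trans (pullback.lift_fst _ _ _))

lemma IsEffectiveDescent.exists_desc_of_isPullback {p : X ⟶ Y} (hp : IsEffectiveDescent p)
    {P Z Z' : C} {q : P ⟶ Z} {b : P ⟶ X} {g : Z ⟶ Y} (hP : IsPullback q b g p) {g' : Z' ⟶ Y}
    (e : P ⟶ Z') (he : e ≫ g' = q ≫ g)
    (h : ∀ {U : C} (a b : U ⟶ P), a ≫ q = b ≫ q → a ≫ e = b ≫ e) :
    ∃ d : Z ⟶ Z', d ≫ g' = g ∧ q ≫ d = e := by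
  obtain ⟨d, hd, hd'⟩ := hp.exists_desc (hP.isoPullback.inv ≫ e)
    (by rw [Category.assoc, he, hP.isoPullback_inv_fst_assoc]) (fun a b hab => by
      simpa using h (a ≫ hP.isoPullback.inv) (b ≫ hP.isoPullback.inv) (by simpa using hab))
  refine ⟨d, hd, ?_⟩
  rw [← hP.isoPullback_hom_fst, Category.assoc, hd', Iso.hom_inv_id_assoc]

/-- If every pullback of `p` is an effective epimorphism, and every descent datum for `p` comes
from an object over the codomain, then `p` is an effective descent morphism. -/
lemma isEffectiveDescent_of {p : X ⟶ Y}
    (h₁ : ∀ {Z : C} (g : Z ⟶ Y), ∃ (P : C) (q : P ⟶ Z) (b : P ⟶ X), IsPullback q b g p ∧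
      ∀ {T : C} (e : P ⟶ T), (∀ {U : C} (a b : U ⟶ P), a ≫ q = b ≫ q → a ≫ e = b ≫ e) →
        ∃! d : Z ⟶ T, q ≫ d = e)
    (h₂ : ∀ A : DescentDatum p, ∃ (E : C) (ε : E ⟶ Y) (k : A.obj ⟶ E),
      IsPullback k A.str ε p ∧ A.act ≫ k = pullback.fst (A.str ≫ p) p ≫ k) :
    IsEffectiveDescent p := by
  have hp {Z : C} (g : Z ⟶ Y) {T : C} (e : pullback g p ⟶ T)
      (he : ∀ {U : C} (a b : U ⟶ pullback g p), a ≫ pullback.fst g p = b ≫ pullback.fst g p →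
        a ≫ e = b ≫ e) : ∃! d : Z ⟶ T, pullback.fst g p ≫ d = e := by
    obtain ⟨P, q, b, hP, h⟩ := h₁ g
    obtain ⟨d, hd, hd'⟩ := h (hP.isoPullback.hom ≫ e) (fun a b hab => by
      rw [← Category.assoc, ← Category.assoc]
      exact he _ _ (by simpa using hab))
    refine ⟨d, ?_, fun d' h' => hd' d' ?_⟩
    · change pullback.fst g p ≫ d = e
      rw [← hP.isoPullback_inv_fst, Category.assoc, hd, Iso.inv_hom_id_assoc]
    · change q ≫ d' = _
      rw [← h', hP.isoPullback_hom_fst_assoc]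
  have full : (descentComparison p).Full := by
    refine ⟨fun {Z Z'} k => ?_⟩
    let k' : pullback Z.hom p ⟶ pullback Z'.hom p := DescentDatum.Hom.hom k
    have hs : k' ≫ pullback.snd Z'.hom p = pullback.snd Z.hom p := DescentDatum.Hom.hom_str k
    have ha : pullback.lift (pullback.fst (pullback.snd Z.hom p ≫ p) p ≫ pullback.fst Z.hom p)
        (pullback.snd (pullback.snd Z.hom p ≫ p) p)
        (by rw [Category.assoc, pullback.condition, pullback.condition]) ≫ k' =
      pullback.lift (f := pullback.snd Z'.hom p ≫ p) (g := p)
          (pullback.fst (pullback.snd Z.hom p ≫ p) p ≫ k') (pullback.snd (pullback.snd Z.hom p ≫ p) p)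
          (by rw [Category.assoc, reassoc_of% hs, pullback.condition]) ≫
        pullback.lift (pullback.fst (pullback.snd Z'.hom p ≫ p) p ≫ pullback.fst Z'.hom p)
          (pullback.snd (pullback.snd Z'.hom p ≫ p) p)
          (by rw [Category.assoc, pullback.condition, pullback.condition]) :=
      DescentDatum.Hom.act_hom k
    -- If `a` and `b` have the same `Z`-component, then `b` is the result of acting on `a` with the
    -- `X`-component of `b`. Since `k'` is equivariant and the action on the target keeps the
    -- `Z'`-component, `k'` sends both to the same point of `Z'`.
    obtain ⟨d, hd, -⟩ := hp Z.hom (k' ≫ pullback.fst Z'.hom p) (fun {U} a b hab => by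
      have hc : a ≫ pullback.snd Z.hom p ≫ p = (b ≫ pullback.snd Z.hom p) ≫ p := by
        rw [← pullback.condition, reassoc_of% hab, Category.assoc, pullback.condition]
      have h₃ := congrArg (fun t => pullback.lift a (b ≫ pullback.snd Z.hom p) hc ≫ t ≫
        pullback.fst Z'.hom p) ha
      simp only [Category.assoc, pullback.lift_fst, pullback.lift_fst_assoc] at h₃
      have h₄ : pullback.lift a (b ≫ pullback.snd Z.hom p) hc ≫
          pullback.lift (pullback.fst (pullback.snd Z.hom p ≫ p) p ≫ pullback.fst Z.hom p)
            (pullback.snd (pullback.snd Z.hom p ≫ p) p)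
            (by rw [Category.assoc, pullback.condition, pullback.condition]) = b := by
        apply pullback.hom_ext
        · simp only [Category.assoc, pullback.lift_fst, pullback.lift_fst_assoc, hab]
        · simp only [Category.assoc, pullback.lift_snd]
      rw [← h₃, reassoc_of% h₄])
    have hw : d ≫ Z'.hom = Z.hom := by
      refine (hp Z.hom (pullback.fst Z.hom p ≫ Z.hom) (fun a b hab => by
        rw [reassoc_of% hab])).unique ?_ rfl
      rw [reassoc_of% hd, pullback.condition, reassoc_of% hs, pullback.condition]
    refine ⟨Over.homMk d hw, DescentDatum.hom_ext (pullback.hom_ext ?_ ?_)⟩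
    · exact (pullback.lift_fst _ _ _).trans hd
    · exact (pullback.lift_snd _ _ _).trans hs.symm
  have faithful : (descentComparison p).Faithful := by
    refine ⟨fun {Z Z' d d'} h => Over.OverMorphism.ext ?_⟩
    have h₃ := congrArg (fun t => DescentDatum.Hom.hom t ≫ pullback.fst Z'.hom p) h
    have h₄ : pullback.fst Z.hom p ≫ d.left = pullback.fst Z.hom p ≫ d'.left :=
      (pullback.lift_fst _ _ _).symm.trans (h₃.trans (pullback.lift_fst _ _ _))
    exact (hp Z.hom (pullback.fst Z.hom p ≫ d'.left) (fun a b hab => by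
      rw [reassoc_of% hab])).unique h₄ rfl
  have essSurj : (descentComparison p).EssSurj := by
    refine ⟨fun A => ?_⟩
    obtain ⟨E, ε, k, hk, h⟩ := h₂ A
    -- The canonical action is replaced by a variable known only through its two projections, so
    -- that rewriting does not unfold it.
    obtain ⟨c, hc, hc₁, hc₂⟩ : ∃ c : pullback (pullback.snd ε p ≫ p) p ⟶ pullback ε p,
        c = (canonicalDescentDatum p ε).act ∧
        c ≫ pullback.fst ε p = pullback.fst (pullback.snd ε p ≫ p) p ≫ pullback.fst ε p ∧
        c ≫ pullback.snd ε p = pullback.snd (pullback.snd ε p ≫ p) p :=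
      ⟨_, rfl, pullback.lift_fst _ _ _, pullback.lift_snd _ _ _⟩
    have hact : c ≫ hk.isoPullback.inv =
        pullback.lift (f := A.str ≫ p) (g := p)
          (pullback.fst (pullback.snd ε p ≫ p) p ≫ hk.isoPullback.inv)
          (pullback.snd (pullback.snd ε p ≫ p) p)
          (by rw [Category.assoc, hk.isoPullback_inv_snd_assoc, pullback.condition]) ≫ A.act := by
      apply hk.hom_ext
      · simp only [Category.assoc, h, hk.isoPullback_inv_fst, pullback.lift_fst_assoc, hc₁]
      · simp only [Category.assoc, A.act_str, hk.isoPullback_inv_snd, pullback.lift_snd, hc₂]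
    have hact' : A.act ≫ hk.isoPullback.hom =
        pullback.lift (f := pullback.snd ε p ≫ p) (g := p)
          (pullback.fst (A.str ≫ p) p ≫ hk.isoPullback.hom) (pullback.snd (A.str ≫ p) p)
          (by rw [Category.assoc, hk.isoPullback_hom_snd_assoc, pullback.condition]) ≫ c := by
      apply pullback.hom_ext
      · simp only [Category.assoc, hk.isoPullback_hom_fst, hc₁, pullback.lift_fst_assoc, h]
      · simp only [Category.assoc, hk.isoPullback_hom_snd, hc₂, pullback.lift_snd, A.act_str]
    subst hc
    exact ⟨Over.mk ε, ⟨
      { hom := { hom := hk.isoPullback.inv, hom_str := hk.isoPullback_inv_snd, act_hom := hact }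
        inv := { hom := hk.isoPullback.hom, hom_str := hk.isoPullback_hom_snd, act_hom := hact' }
        hom_inv_id := DescentDatum.hom_ext hk.isoPullback.inv_hom_id
        inv_hom_id := DescentDatum.hom_ext hk.isoPullback.hom_inv_id }⟩⟩
  exact { full := full, faithful := faithful, essSurj := essSurj }

end DescentPoints

/-! ## Universally effective-epimorphic families -/

section Covering

variable {V : Type u} [Category.{v} V]

/-- A family of morphisms is covering if it generates a covering sieve of the canonical topology,
that is, if it is universally effective-epimorphic. -/
def IsCovering {ι : Type*} {X : ι → V} {Y : V} (c : ∀ i, X i ⟶ Y) : Prop :=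
  Sieve.ofArrows X c ∈ Sheaf.canonicalTopology V Y

/-- A family of morphisms is universally epimorphic if its pullbacks are jointly epimorphic. -/
def IsUnivEpi {ι : Type*} {X : ι → V} {Y : V} (c : ∀ i, X i ⟶ Y) : Prop :=
  ∀ ⦃Z : V⦄ (g : Z ⟶ Y) ⦃T : V⦄ (s t : Z ⟶ T),
    (∀ i ⦃U : V⦄ (a : U ⟶ X i) (b : U ⟶ Z), a ≫ c i = b ≫ g → b ≫ s = b ≫ t) → s = t

variable {ι κ : Type*} {X : ι → V} {Y : V} {c : ∀ i, X i ⟶ Y}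

lemma mem_ofArrows_iff' {U : V} (f : U ⟶ Y) :
    Sieve.ofArrows X c f ↔ ∃ i, ∃ a : U ⟶ X i, a ≫ c i = f := by
  rw [Sieve.mem_ofArrows_iff]
  exact ⟨fun ⟨i, a, h⟩ => ⟨i, a, h.symm⟩, fun ⟨i, a, h⟩ => ⟨i, a, h.symm⟩⟩

/-- Representables are sheaves for the canonical topology, hence separated for the pullback of the
sieve along any `g`. -/
lemma IsCovering.isUnivEpi (hc : IsCovering c) : IsUnivEpi c := by
  intro Z g T s t h
  have hs := (Sheaf.isSheaf_yoneda_obj T).isSeparated _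
    ((Sheaf.canonicalTopology V).pullback_stable g hc)
  refine hs.ext fun U b hb => ?_
  obtain ⟨i, a, ha⟩ := (mem_ofArrows_iff' _).1 hb
  exact h i a b ha

lemma IsUnivEpi.hom_ext (hc : IsUnivEpi c) {T : V} {s t : Y ⟶ T} (h : ∀ i, c i ≫ s = c i ≫ t) :
    s = t :=
  hc (𝟙 Y) s t fun i U a b hab => by
    rw [Category.comp_id] at hab
    rw [← hab, Category.assoc, Category.assoc, h]

lemma IsCovering.existsUnique_desc (hc : IsCovering c) {T : V} (e : ∀ i, X i ⟶ T)
    (he : ∀ i j ⦃U : V⦄ (a : U ⟶ X i) (b : U ⟶ X j), a ≫ c i = b ≫ c j → a ≫ e i = b ≫ e j) :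
    ∃! d : Y ⟶ T, ∀ i, c i ≫ d = e i := by
  have h : Presieve.IsSheafFor (yoneda.obj T) (Presieve.ofArrows X c) := by
    rw [Presieve.isSheafFor_iff_generate]
    exact Sheaf.isSheaf_yoneda_obj T _ hc
  exact (Presieve.isSheafFor_arrows_iff _ _).1 h e fun i j U a b hab => he i j a b hab

lemma IsCovering.of_factors {X' : κ → V} {c' : ∀ k, X' k ⟶ Y} (hc : IsCovering c)
    (h : ∀ i, ∃ k, ∃ a : X i ⟶ X' k, a ≫ c' k = c i) : IsCovering c' := by
  refine (Sheaf.canonicalTopology V).superset_covering (fun U f hf => ?_) hc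
  obtain ⟨i, a, rfl⟩ := (mem_ofArrows_iff' _).1 hf
  obtain ⟨k, b, hb⟩ := h i
  exact (mem_ofArrows_iff' _).2 ⟨k, a ≫ b, by rw [Category.assoc, hb]⟩

lemma IsUnivEpi.of_factors {X' : κ → V} {c' : ∀ k, X' k ⟶ Y} (hc : IsUnivEpi c)
    (h : ∀ i, ∃ k, ∃ a : X i ⟶ X' k, a ≫ c' k = c i) : IsUnivEpi c' := by
  intro Z g T s t hst
  refine hc g s t fun i U a b hab => ?_
  obtain ⟨k, a', ha'⟩ := h i
  exact hst k (a ≫ a') b (by rw [Category.assoc, ha', hab])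

lemma IsCovering.of_isPullback (hc : IsCovering c) {Z : V} {g : Z ⟶ Y} {P : ι → V}
    {p : ∀ i, P i ⟶ X i} {q : ∀ i, P i ⟶ Z} (h : ∀ i, IsPullback (p i) (q i) (c i) g) :
    IsCovering q := by
  refine (Sheaf.canonicalTopology V).superset_covering (fun U f hf => ?_)
    ((Sheaf.canonicalTopology V).pullback_stable g hc)
  obtain ⟨i, a, ha⟩ := (mem_ofArrows_iff' _).1 hf
  exact (mem_ofArrows_iff' _).2 ⟨i, (h i).lift a f ha, (h i).lift_snd _ _ _⟩

lemma IsUnivEpi.of_isPullback (hc : IsUnivEpi c) {Z : V} {g : Z ⟶ Y} {P : ι → V}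
    {p : ∀ i, P i ⟶ X i} {q : ∀ i, P i ⟶ Z} (h : ∀ i, IsPullback (p i) (q i) (c i) g) :
    IsUnivEpi q := by
  intro W f T s t hst
  refine hc (f ≫ g) s t fun i U a b hab => ?_
  exact hst i ((h i).lift a (b ≫ f) (by rw [hab, Category.assoc])) b ((h i).lift_snd _ _ _)

lemma IsCovering.comp_iso (hc : IsCovering c) {Y' : V} (e : Y ≅ Y') :
    IsCovering (fun i => c i ≫ e.hom) :=
  hc.of_isPullback (g := e.inv) (p := fun i => 𝟙 (X i)) fun i =>
    IsPullback.of_horiz_isIso ⟨by simp⟩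

lemma IsUnivEpi.comp_iso (hc : IsUnivEpi c) {Y' : V} (e : Y ≅ Y') :
    IsUnivEpi (fun i => c i ≫ e.hom) :=
  hc.of_isPullback (g := e.inv) (p := fun i => 𝟙 (X i)) fun i =>
    IsPullback.of_horiz_isIso ⟨by simp⟩

/-- The canonical topology is the finest one for which representables are sheaves. A sieve therefore
covers once all its pullbacks satisfy the sheaf condition for representables, and these pullbacks
are generated by the pulled back families. -/
lemma isCovering_of_pullbacks [HasPullbacks V]
    (h : ∀ ⦃Z : V⦄ (g : Z ⟶ Y) ⦃T : V⦄ (e : ∀ i, pullback (c i) g ⟶ T),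
      (∀ i j ⦃U : V⦄ (a : U ⟶ pullback (c i) g) (b : U ⟶ pullback (c j) g),
        a ≫ pullback.snd (c i) g = b ≫ pullback.snd (c j) g → a ≫ e i = b ≫ e j) →
      ∃! d : Z ⟶ T, ∀ i, pullback.snd (c i) g ≫ d = e i) : IsCovering c := by
  refine Sheaf.mem_finestTopology_of_forall_isSheafFor ?_
  rintro _ ⟨T, rfl⟩ Z g
  have e : (Sieve.ofArrows X c).pullback g =
      Sieve.ofArrows _ (fun i => pullback.snd (c i) g) := by
    apply Sieve.ext
    intro U f
    refine Iff.trans (mem_ofArrows_iff' _) (Iff.trans ?_ (mem_ofArrows_iff' _).symm)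
    constructor
    · rintro ⟨i, a, ha⟩
      exact ⟨i, pullback.lift a f ha, pullback.lift_snd _ _ _⟩
    · rintro ⟨i, a, rfl⟩
      exact ⟨i, a ≫ pullback.fst _ _, by rw [Category.assoc, Category.assoc, pullback.condition]⟩
  rw [e]
  refine (Presieve.isSheafFor_iff_generate _).1 ((Presieve.isSheafFor_arrows_iff _ _).2 ?_)
  intro x hx
  exact h g x fun i j U a b hab => hx i j U a b hab

/-- A multicofork on the join diagram is a compatible family for the generated sieve, so the stable
colimit property is the sheaf condition for representables on every pullback. -/
lemma StableJoinIs.isCovering [HasPullbacks V] {ι : Type w} {X : ι → V} {c : ∀ i, X i ⟶ Y}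
    (hc : StableJoinIs c) : IsCovering c := by
  refine isCovering_of_pullbacks fun Z g T e he => ?_
  obtain ⟨hl⟩ := hc.2 g
  refine ⟨hl.desc (Multicofork.ofπ _ T e fun a => he _ _ _ _ pullback.condition), fun i =>
    hl.fac (Multicofork.ofπ _ T e fun a => he _ _ _ _ pullback.condition) (.right i),
    fun d hd => Multicofork.IsColimit.hom_ext hl fun i => ?_⟩
  exact (hd i).trans
    (hl.fac (Multicofork.ofπ _ T e fun a => he _ _ _ _ pullback.condition) (.right i)).symm

/-- Descent of morphisms along a regular epimorphism. -/
lemma existsUnique_desc_of_isRegularEpi {A B T : V} (p : A ⟶ B) [IsRegularEpi p] (e : A ⟶ T)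
    (he : ∀ ⦃U : V⦄ (a b : U ⟶ A), a ≫ p = b ≫ p → a ≫ e = b ≫ e) :
    ∃! d : B ⟶ T, p ≫ d = e := by
  have hp := IsRegularEpi.getStruct p
  have h : hp.left ≫ e = hp.right ≫ e := he _ _ hp.w
  refine ⟨Cofork.IsColimit.desc hp.isColimit e h, Cofork.IsColimit.π_desc' hp.isColimit e h,
    fun d hd => ?_⟩
  rw [← cancel_epi p, hd]
  exact (Cofork.IsColimit.π_desc' hp.isColimit e h).symm

/-! ### Regular epimorphisms and covering families -/

section Regular

variable [Regular V]

lemma isCovering_of_isRegularEpi {A B : V} (p : A ⟶ B) [IsRegularEpi p] :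
    IsCovering (fun _ : Unit => p) :=
  isCovering_of_pullbacks fun Z g T e he => by
    obtain ⟨d, hd, h⟩ := existsUnique_desc_of_isRegularEpi (pullback.snd p g) (e ⟨⟩)
      fun U a b hab => he ⟨⟩ ⟨⟩ a b hab
    exact ⟨d, fun _ => hd, fun d' hd' => h d' (hd' ⟨⟩)⟩

/-- Transitivity of the topology: pulled back along a map that factors as `a ≫ c i`, the composite
sieve contains the pullback along `a` of the covering sieve of `p i`. -/
lemma IsCovering.regularEpi_comp {X' : ι → V} (hc : IsCovering c) (p : ∀ i, X' i ⟶ X i)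
    [hp : ∀ i, IsRegularEpi (p i)] : IsCovering (fun i => p i ≫ c i) := by
  refine (Sheaf.canonicalTopology V).transitive hc _ fun U f hf => ?_
  obtain ⟨i, a, rfl⟩ := (mem_ofArrows_iff' _).1 hf
  refine (Sheaf.canonicalTopology V).superset_covering (fun W f hf => ?_)
    ((Sheaf.canonicalTopology V).pullback_stable a (isCovering_of_isRegularEpi (p i)))
  obtain ⟨-, b, hb⟩ := (mem_ofArrows_iff' _).1 hf
  exact (mem_ofArrows_iff' _).2 ⟨i, b, by rw [reassoc_of% hb]⟩

/-- A generalized element of `X i` lifts to `X' i` after composition with a pullback of `p i`, which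
is an epimorphism and can be cancelled. -/
lemma IsUnivEpi.regularEpi_comp {X' : ι → V} (hc : IsUnivEpi c) (p : ∀ i, X' i ⟶ X i)
    [hp : ∀ i, IsRegularEpi (p i)] : IsUnivEpi (fun i => p i ≫ c i) := by
  intro Z g T s t hst
  refine hc g s t fun i U a b hab => ?_
  rw [← cancel_epi (pullback.snd (p i) a), ← Category.assoc, ← Category.assoc]
  exact hst i (pullback.fst (p i) a) _ (by rw [pullback.condition_assoc, hab, Category.assoc])

lemma isRegularEpi_of_isPullback {P A B D : V} {a : P ⟶ A} {b : P ⟶ B} {f : A ⟶ D} {g : B ⟶ D}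
    (h : IsPullback a b f g) [hf : IsRegularEpi f] : IsRegularEpi b :=
  Regular.regularEpiIsStableUnderBaseChange.of_isPullback h hf

end Regular

end Covering

/-! ## Descent along families -/

section FamilyDescent

variable {V : Type u} [Category.{v} V] {Y : V}

/-- An action on the family `s i : A i ⟶ X i` of the kernel pair of the family `c i : X i ⟶ Y`,
given on generalized elements. -/
structure FamilyAction {ι : Type w} {X : ι → V} (c : ∀ i, X i ⟶ Y) {A : ι → V}
    (s : ∀ i, A i ⟶ X i) where
  act : ∀ {i j : ι} {T : V} (a : T ⟶ A i) (x : T ⟶ X j), a ≫ s i ≫ c i = x ≫ c j → (T ⟶ A j)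
  comp_act : ∀ {i j : ι} {T T' : V} (t : T' ⟶ T) (a : T ⟶ A i) (x : T ⟶ X j)
    (h : a ≫ s i ≫ c i = x ≫ c j) (h' : (t ≫ a) ≫ s i ≫ c i = (t ≫ x) ≫ c j),
    t ≫ act a x h = act (t ≫ a) (t ≫ x) h'
  act_str : ∀ {i j : ι} {T : V} (a : T ⟶ A i) (x : T ⟶ X j) (h : a ≫ s i ≫ c i = x ≫ c j),
    act a x h ≫ s j = x
  act_unit : ∀ {i : ι} {T : V} (a : T ⟶ A i) (x : T ⟶ X i) (h : a ≫ s i ≫ c i = x ≫ c i),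
    a ≫ s i = x → act a x h = a
  act_act : ∀ {i j k : ι} {T : V} (a : T ⟶ A i) (x : T ⟶ X j) (x' : T ⟶ X k)
    (h : a ≫ s i ≫ c i = x ≫ c j) (h' : act a x h ≫ s j ≫ c j = x' ≫ c k)
    (h'' : a ≫ s i ≫ c i = x' ≫ c k), act (act a x h) x' h' = act a x' h''

/-- Every action of the kernel pair of the family `c` comes from an object over `Y`. -/
def HasFamilyDescent {ι : Type w} {X : ι → V} (c : ∀ i, X i ⟶ Y) : Prop :=
  ∀ {A : ι → V} (s : ∀ i, A i ⟶ X i) (α : FamilyAction c s),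
    ∃ (E : V) (ε : E ⟶ Y) (k : ∀ i, A i ⟶ E), (∀ i, IsPullback (k i) (s i) ε (c i)) ∧
      ∀ {i j : ι} {T : V} (a : T ⟶ A i) (x : T ⟶ X j) (h : a ≫ s i ≫ c i = x ≫ c j),
        α.act a x h ≫ k j = a ≫ k i

namespace FamilyAction

variable {ι : Type w} {X : ι → V} {c : ∀ i, X i ⟶ Y} {A : ι → V} {s : ∀ i, A i ⟶ X i}

lemma act_congr (α : FamilyAction c s) {i j : ι} {T : V} {a a' : T ⟶ A i} {x x' : T ⟶ X j}
    (ha : a = a') (hx : x = x') (h : a ≫ s i ≫ c i = x ≫ c j) (h' : a' ≫ s i ≫ c i = x' ≫ c j) :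
    α.act a x h = α.act a' x' h' := by
  subst ha hx
  rfl

lemma act_str_assoc (α : FamilyAction c s) {i j : ι} {T : V} (a : T ⟶ A i) (x : T ⟶ X j)
    (h : a ≫ s i ≫ c i = x ≫ c j) {Z : V} (f : X j ⟶ Z) : α.act a x h ≫ s j ≫ f = x ≫ f := by
  rw [← Category.assoc, α.act_str]

end FamilyAction

open FormalCoproduct

/-- Index functions into a one-member family agree definitionally, so the components can be compared
without transport. -/
lemma φ_eq_of_eq {Z : FormalCoproduct.{w} V} {f g : Z ⟶ (incl.{w} V).obj Y} (h : f = g) (z : Z.I) :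
    (show Z.obj z ⟶ Y from f.φ z) = g.φ z := by
  subst h
  rfl

section

variable [HasPullbacks V] {ι : Type w} {X : ι → V} {c : ∀ i, X i ⟶ Y}

lemma famHom_pullback_hom_ext {Z : V} (g : Z ⟶ Y) {W : FormalCoproduct.{w} V}
    {d d' : W ⟶ FormalCoproduct.mk ι (fun i => pullback (c i) g)}
    (h₁ : d ≫ famHom (fun i => pullback.snd (c i) g) =
      d' ≫ famHom (fun i => pullback.snd (c i) g))
    (h₂ : d ≫ (⟨id, fun i => pullback.fst (c i) g⟩ :
      FormalCoproduct.mk ι (fun i => pullback (c i) g) ⟶ FormalCoproduct.mk ι X) =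
      d' ≫ (⟨id, fun i => pullback.fst (c i) g⟩ :
      FormalCoproduct.mk ι (fun i => pullback (c i) g) ⟶ FormalCoproduct.mk ι X)) : d = d' := by
  obtain ⟨f, φ⟩ := d
  obtain ⟨f', φ'⟩ := d'
  obtain rfl : f = f' := congrArg FormalCoproduct.Hom.f h₂
  refine FormalCoproduct.hom_ext rfl fun z => ?_
  refine (Category.comp_id _).trans (pullback.hom_ext ?_ ?_)
  · obtain ⟨_, h⟩ := (FormalCoproduct.hom_ext_iff' _ _).1 h₂ z
    exact (Category.comp_id _).symm.trans h
  · exact φ_eq_of_eq h₁ z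

/-- The base has a single member, so a pullback in `Fam(V)` imposes no condition on indices and is
computed member by member. -/
lemma isPullback_famHom {Z : V} (g : Z ⟶ Y) :
    IsPullback (famHom fun i => pullback.snd (c i) g)
      (⟨id, fun i => pullback.fst (c i) g⟩ :
        FormalCoproduct.mk ι (fun i => pullback (c i) g) ⟶ FormalCoproduct.mk ι X)
      ((incl.{w} V).map g) (famHom c) where
  w := FormalCoproduct.hom_ext rfl fun i => (Category.comp_id _).trans pullback.condition.symm
  isLimit' := by
    refine ⟨PullbackCone.IsLimit.mk _
      (fun t => ⟨t.snd.f, fun z => pullback.lift (f := c (t.snd.f z)) (g := g) (t.snd.φ z)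
        (t.fst.φ z) (φ_eq_of_eq t.condition z).symm⟩)
      (fun t => ?_) (fun t => ?_) (fun t d h₁ h₂ => ?_)⟩
    · exact FormalCoproduct.hom_ext rfl fun z => (Category.comp_id _).trans (pullback.lift_snd _ _ _)
    · exact FormalCoproduct.hom_ext rfl fun z => (Category.comp_id _).trans (pullback.lift_fst _ _ _)
    · refine famHom_pullback_hom_ext g (h₁.trans ?_) (h₂.trans ?_)
      · exact FormalCoproduct.hom_ext rfl fun z =>
          (Category.comp_id _).trans (pullback.lift_snd _ _ _).symm
      · exact FormalCoproduct.hom_ext rfl fun z =>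
          (Category.comp_id _).trans (pullback.lift_fst _ _ _).symm

/-- This is the source of surjectivity on objects. Over an empty family the pullback of the identity
of `Y` is empty, so its map to the empty family would descend to a map from the one-member family
`Y` to the empty one. -/
lemma IsEffectiveDescent.nonempty_index (hc : IsEffectiveDescent (famHom c)) : Nonempty ι := by
  by_contra hι
  let Z' : FormalCoproduct.{w} V := ⟨PEmpty, PEmpty.elim⟩
  let P := pullback (𝟙 ((incl.{w} V).obj Y)) (famHom c)
  have hP : P.I → False := fun a => hι ⟨(pullback.snd _ (famHom c) : P ⟶ _).f a⟩
  obtain ⟨d, -, -⟩ := hc.exists_desc (g := 𝟙 ((incl.{w} V).obj Y)) (Z' := Z')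
    (g' := ⟨PEmpty.elim, fun i => i.elim⟩)
    ⟨fun a => (hP a).elim, fun a => (hP a).elim⟩
    (FormalCoproduct.hom_ext (funext fun a => (hP a).elim) fun a => (hP a).elim)
    (fun {U} a b _ => FormalCoproduct.hom_ext (funext fun z => (hP (a.f z)).elim)
      fun z => (hP (a.f z)).elim)
  exact (d.f PUnit.unit).elim

variable [CartesianMonoidalCategory V]

/-- Faithfulness only compares morphisms over `Y`, so `s` and `t` are replaced by `(s, g)` and `(t,
g)` with values in `T ⊗ Y`. -/
lemma IsAlmostDescent.isUnivEpi (hc : IsAlmostDescent (famHom c)) : IsUnivEpi c := by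
  intro Z g T s t hst
  have h : (incl.{w} V).map (CartesianMonoidalCategory.lift s g) =
      (incl.{w} V).map (CartesianMonoidalCategory.lift t g) := by
    refine hc.hom_ext_of_isPullback (isPullback_famHom g)
      (g' := (incl.{w} V).map (SemiCartesianMonoidalCategory.snd T Y)) ?_ ?_ ?_
    · rw [← Functor.map_comp, CartesianMonoidalCategory.lift_snd]
    · rw [← Functor.map_comp, CartesianMonoidalCategory.lift_snd]
    · refine FormalCoproduct.hom_ext rfl fun i => (Category.comp_id _).trans ?_
      change pullback.snd (c i) g ≫ CartesianMonoidalCategory.lift s g =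
        pullback.snd (c i) g ≫ CartesianMonoidalCategory.lift t g
      rw [CartesianMonoidalCategory.comp_lift, CartesianMonoidalCategory.comp_lift,
        hst i (pullback.fst (c i) g) (pullback.snd (c i) g) pullback.condition]
  have h' := congrArg (· ≫ SemiCartesianMonoidalCategory.fst T Y) ((incl.{w} V).map_injective h)
  simpa using h'

/-- The passage to `T ⊗ Y` over `Y` is used again: fullness provides the descended morphism, and
universal epimorphy its uniqueness. -/
lemma IsEffectiveDescent.isCovering (hc : IsEffectiveDescent (famHom c)) : IsCovering c := by
  refine isCovering_of_pullbacks fun Z g T e he => ?_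
  obtain ⟨d, hd, hd'⟩ := hc.exists_desc_of_isPullback (isPullback_famHom g)
    (Z' := (incl.{w} V).obj (T ⊗ Y))
    (g' := (incl.{w} V).map (SemiCartesianMonoidalCategory.snd T Y))
    (famHom fun i => CartesianMonoidalCategory.lift (e i) (pullback.snd (c i) g ≫ g))
    (FormalCoproduct.hom_ext rfl fun i => (Category.comp_id _).trans
      (CartesianMonoidalCategory.lift_snd _ _))
    (fun {U} a b hab => by
      refine FormalCoproduct.hom_ext rfl fun z => (Category.comp_id _).trans ?_
      have h₁ : a.φ z ≫ pullback.snd (c (a.f z)) g = b.φ z ≫ pullback.snd (c (b.f z)) g :=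
        φ_eq_of_eq hab z
      change a.φ z ≫ CartesianMonoidalCategory.lift (e (a.f z)) (pullback.snd (c (a.f z)) g ≫ g) =
        b.φ z ≫ CartesianMonoidalCategory.lift (e (b.f z)) (pullback.snd (c (b.f z)) g ≫ g)
      rw [CartesianMonoidalCategory.comp_lift, CartesianMonoidalCategory.comp_lift,
        reassoc_of% h₁, he _ _ _ _ h₁])
  obtain ⟨d, rfl⟩ := (incl.{w} V).map_surjective d
  have hi (i : ι) : pullback.snd (c i) g ≫ d =
      CartesianMonoidalCategory.lift (e i) (pullback.snd (c i) g ≫ g) := φ_eq_of_eq hd' i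
  refine ⟨d ≫ SemiCartesianMonoidalCategory.fst T Y, fun i => ?_, fun d' hd' => ?_⟩
  · exact (Category.assoc _ _ _).symm.trans ((congrArg (· ≫ _) (hi i)).trans
      (CartesianMonoidalCategory.lift_fst _ _))
  · refine hc.isAlmostDescent.isUnivEpi g _ _ fun i U a b hab => ?_
    have h₁ := congrArg (fun t => pullback.lift a b hab ≫ t ≫ SemiCartesianMonoidalCategory.fst T Y)
      (hi i)
    have h₂ := congrArg (fun t => pullback.lift a b hab ≫ t) (hd' i)
    simp only [Category.assoc, CartesianMonoidalCategory.lift_fst, pullback.lift_snd_assoc] at h₁ h₂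
    exact h₂.trans h₁.symm

end

/-- Descent along `famHom c` in the category of families gives descent along the family `c`. -/
lemma HasDescent.hasFamilyDescent {ι : Type w} [Nonempty ι] {X : ι → V}
    {c : ∀ i, X i ⟶ Y} [HasPullbacks V] (hc : HasDescent (famHom c)) : HasFamilyDescent c := by
  intro A s α
  let str : FormalCoproduct.mk ι A ⟶ FormalCoproduct.mk ι X := ⟨id, s⟩
  let β : PointAction (famHom c) str :=
    { act a x h := ⟨x.f, fun t => α.act (a.φ t) (x.φ t) (φ_eq_of_eq h t)⟩
      comp_act t a x h h' := FormalCoproduct.hom_ext rfl fun z =>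
        (Category.comp_id _).trans (α.comp_act _ _ _ _ _)
      act_str a x h := FormalCoproduct.hom_ext rfl fun z =>
        (Category.comp_id _).trans (α.act_str _ _ _)
      act_unit a x h hx := by
        subst hx
        exact FormalCoproduct.hom_ext rfl fun z =>
          (Category.comp_id _).trans (α.act_unit _ _ _ rfl)
      act_act a x x' h h' h'' := FormalCoproduct.hom_ext rfl fun z =>
        (Category.comp_id _).trans (α.act_act _ _ _ _ _ _) }
  obtain ⟨E, ε, k, hk, hβ⟩ := hc str β
  -- The descended object is a family, and it must have exactly one member. The pullback of `E.obj
  -- κ` and `X i` over `Y` maps to the family `A`; the projection to `X` puts this map at index `i`,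
  -- and the projection to `E` then gives `k.f i = κ`.
  have hf (κ : E.I) (i : ι) : k.f i = κ := by
    let P := pullback (show E.obj κ ⟶ Y from ε.φ κ) (c i)
    let a : (incl.{w} V).obj P ⟶ E := .fromIncl κ (pullback.fst _ _)
    let b : (incl.{w} V).obj P ⟶ FormalCoproduct.mk ι X :=
      Hom.fromIncl (Y := FormalCoproduct.mk ι X) i (pullback.snd (show E.obj κ ⟶ Y from ε.φ κ) (c i))
    have hab : a ≫ ε = b ≫ famHom c := FormalCoproduct.hom_ext rfl fun _ =>
      (Category.comp_id _).trans pullback.condition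
    have h₁ : k.f ((hk.lift a b hab).f PUnit.unit) = κ :=
      congrFun (congrArg FormalCoproduct.Hom.f (hk.lift_fst a b hab)) PUnit.unit
    have h₂ : (hk.lift a b hab).f PUnit.unit = i :=
      congrFun (congrArg FormalCoproduct.Hom.f (hk.lift_snd a b hab)) PUnit.unit
    rw [← h₁, h₂]
  obtain ⟨i₀⟩ := ‹Nonempty ι›
  let κ₀ := k.f i₀
  have hκ (κ : E.I) : κ = κ₀ := (hf κ i₀).symm
  let u : E ≅ (incl.{w} V).obj (E.obj κ₀) := isoOfComponents
    ⟨fun _ => PUnit.unit, fun _ => κ₀, fun κ => (hκ κ).symm, fun _ => rfl⟩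
    (fun κ => eqToIso (by rw [hκ κ]; rfl))
  have hk' : IsPullback (k ≫ u.hom) str (u.inv ≫ ε) (famHom c) :=
    IsPullback.of_iso hk (Iso.refl _) u (Iso.refl _) (Iso.refl _) (by simp) (by simp) (by simp)
      (by simp)
  have hβ' {i j : ι} {T : V} (a : T ⟶ A i) (x : T ⟶ X j) (h : a ≫ s i ≫ c i = x ≫ c j) :
      α.act a x h ≫ (k ≫ u.hom).φ j = a ≫ (k ≫ u.hom).φ i := by
    have h₁ := hβ (Hom.fromIncl (Y := FormalCoproduct.mk ι A) i a)
      (Hom.fromIncl (Y := FormalCoproduct.mk ι X) j x) (FormalCoproduct.hom_ext rfl fun _ =>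
        (Category.comp_id _).trans h)
    exact φ_eq_of_eq ((Category.assoc _ _ _).symm.trans
      ((congrArg (· ≫ u.hom) h₁).trans (Category.assoc _ _ _))) PUnit.unit
  generalize k ≫ u.hom = k' at hk' hβ'
  generalize u.inv ≫ ε = ε' at hk'
  refine ⟨E.obj κ₀, ε'.φ PUnit.unit, k'.φ, fun i => ⟨⟨φ_eq_of_eq hk'.w i⟩, ?_⟩, hβ'⟩
  refine ⟨PullbackCone.isLimitAux' _ fun t => ?_⟩
  have ht : (incl.{w} V).map t.fst ≫ ε' =
      Hom.fromIncl (Y := FormalCoproduct.mk ι X) i t.snd ≫ famHom c :=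
    FormalCoproduct.hom_ext rfl fun _ => (Category.comp_id _).trans t.condition
  -- A map from a one-member family into `A` selects one index, and the projection to the family `X`
  -- forces it to be `i`.
  have H : ∃ l : t.pt ⟶ A i, l ≫ k'.φ i = t.fst ∧ l ≫ s i = t.snd := by
    have h₁ := hk'.lift_fst _ _ ht
    have h₂ := hk'.lift_snd _ _ ht
    obtain ⟨⟨j, b⟩, hb⟩ := (inclHomEquiv _ _).symm.surjective (hk'.lift _ _ ht)
    rw [← hb] at h₁ h₂
    obtain ⟨h₃, h₄⟩ := (FormalCoproduct.hom_ext_iff' _ _).1 h₂ PUnit.unit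
    obtain rfl : j = i := h₃
    exact ⟨b, φ_eq_of_eq h₁ PUnit.unit, (Category.comp_id _).symm.trans h₄⟩
  refine ⟨H.choose, H.choose_spec.1, H.choose_spec.2, fun {m} hm₁ hm₂ => ?_⟩
  have h₁ : Hom.fromIncl (Y := FormalCoproduct.mk ι A) i m =
      Hom.fromIncl (Y := FormalCoproduct.mk ι A) i H.choose := by
    apply hk'.hom_ext
    · exact FormalCoproduct.hom_ext rfl fun _ =>
        (Category.comp_id _).trans (hm₁.trans H.choose_spec.1.symm)
    · exact FormalCoproduct.hom_ext rfl fun _ =>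
        (Category.comp_id _).trans (hm₂.trans H.choose_spec.2.symm)
  obtain ⟨h₃, h₄⟩ := (FormalCoproduct.hom_ext_iff' _ _).1 h₁ PUnit.unit
  exact (Category.comp_id _).symm.trans h₄

end FamilyDescent

/-! ### Reindexing and composition for descent along families -/

section FamilyDescentComp

open FormalCoproduct

variable {V : Type u} [Category.{v} V] {Y : V}

/-- The bijection is needed because hom-objects between orbits are indexed by members of the orbits,
not by the fibres of `F`. -/
lemma IsEffectiveDescent.hasFamilyDescent [HasPullbacks V] {ι ι' : Type w} {X : ι' → V}
    {c : ∀ i, X i ⟶ Y} (hc : IsEffectiveDescent (famHom c)) (σ : ι ≃ ι') :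
    HasFamilyDescent (fun i => c (σ i)) := by
  let e : FormalCoproduct.mk ι (fun i => X (σ i)) ≅ FormalCoproduct.mk ι' X :=
    isoOfComponents σ fun i => Iso.refl _
  have he : e.hom ≫ famHom c = famHom (fun i => c (σ i)) :=
    FormalCoproduct.hom_ext rfl fun i => (Category.comp_id _).trans (Category.id_comp _)
  have : Nonempty ι := hc.nonempty_index.map σ.symm
  apply HasDescent.hasFamilyDescent
  rw [← he]
  exact HasDescent.iso_comp hc.hasDescent

/-- The class in `B` of a result of the action depends only on the classes of its arguments. As `A
i` is the pullback of `B i` and `X i`, acting on `a` with `a' ≫ s i` gives `a'`, so `a` and `a'`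
give the same result at `x'`. Changing `x` to `x'` is a further action along the kernel pair of `p
j`, invisible in `B j`. -/
lemma FamilyAction.exists_comp_eq {ι : Type w} {X M A B : ι → V} {c : ∀ i, M i ⟶ Y}
    {p : ∀ i, X i ⟶ M i} {s : ∀ i, A i ⟶ X i} (α : FamilyAction (fun i => p i ≫ c i) s)
    {r : ∀ i, A i ⟶ B i} {t : ∀ i, B i ⟶ M i} (hr : ∀ i, IsPullback (r i) (s i) (t i) (p i))
    (hα : ∀ {i : ι} {T : V} (a : T ⟶ A i) (x : T ⟶ X i)
      (h : a ≫ s i ≫ p i ≫ c i = x ≫ p i ≫ c i), a ≫ s i ≫ p i = x ≫ p i →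
        α.act a x h ≫ r i = a ≫ r i)
    {i j : ι} {T : V} {a a' : T ⟶ A i} {x x' : T ⟶ X j} (h : a ≫ s i ≫ p i ≫ c i = x ≫ p j ≫ c j)
    (h' : a' ≫ s i ≫ p i ≫ c i = x' ≫ p j ≫ c j) (ha : a ≫ r i = a' ≫ r i)
    (hx : x ≫ p j = x' ≫ p j) : α.act a x h ≫ r j = α.act a' x' h' ≫ r j := by
  have h₀ (i) : s i ≫ p i = r i ≫ t i := (hr i).w.symm
  have h₁ : a ≫ s i ≫ p i = (a' ≫ s i) ≫ p i := by
    rw [Category.assoc, h₀, reassoc_of% ha]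
  have h₁' : a ≫ s i ≫ p i ≫ c i = (a' ≫ s i) ≫ p i ≫ c i := by
    simpa only [Category.assoc] using congrArg (· ≫ c i) h₁
  have h₂ : α.act a (a' ≫ s i) h₁' = a' :=
    (hr i).hom_ext ((hα _ _ _ h₁).trans ha) (α.act_str _ _ _)
  have h₃ : α.act a' x' h' = α.act a x' (by rw [h, reassoc_of% hx]) := by
    rw [← α.act_act a (a' ≫ s i) x' h₁' (by rw [α.act_str_assoc, Category.assoc, h'])]
    exact α.act_congr h₂.symm rfl _ _
  rw [h₃, ← α.act_act a x x' h (by rw [α.act_str_assoc, reassoc_of% hx]), hα]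
  rw [α.act_str_assoc, hx]

variable [Regular V]

/-- Descent along the composite of a family of regular epimorphisms that admit descent and of a
family that admits descent. -/
lemma HasFamilyDescent.regularEpi_comp {ι : Type w} {X M : ι → V} {c : ∀ i, M i ⟶ Y}
    (hc : HasFamilyDescent c) {p : ∀ i, X i ⟶ M i} [∀ i, IsRegularEpi (p i)]
    (hp : ∀ i, HasDescent (p i)) : HasFamilyDescent (fun i => p i ≫ c i) := by
  intro A s α
  have H (i : ι) : ∃ (B : V) (t : B ⟶ M i) (r : A i ⟶ B), IsPullback r (s i) t (p i) ∧
      ∀ {T : V} (a : T ⟶ A i) (x : T ⟶ X i)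
      (h : a ≫ s i ≫ p i ≫ c i = x ≫ p i ≫ c i), a ≫ s i ≫ p i = x ≫ p i →
        α.act a x h ≫ r = a ≫ r := by
    -- First stage: the kernel pair of `p i` is contained in that of `p i ≫ c i`, so the action
    -- restricts to it and `A i` descends to `B i` over `M i`.
    let β : PointAction (p i) (s i) :=
      { act a x h := α.act a x (by simpa only [Category.assoc] using congrArg (· ≫ c i) h)
        comp_act t a x h h' := α.comp_act _ _ _ _ _
        act_str a x h := α.act_str _ _ _
        act_unit a x h hx := α.act_unit _ _ _ hx
        act_act a x x' h h' h'' := α.act_act _ _ _ _ _ _ }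
    obtain ⟨B, t, r, hr, hβ⟩ := hp i (s i) β
    exact ⟨B, t, r, hr, fun a x h h' => hβ a x h'⟩
  choose B t r hr hα using H
  have h₀ (i) : s i ≫ p i = r i ≫ t i := (hr i).w.symm
  have hr' (i) : IsRegularEpi (r i) := isRegularEpi_of_isPullback (hr i).flip
  -- generalized elements of `B i` lift locally to `A i`
  have lift_r {i : ι} {T : V} (y : T ⟶ B i) : ∃ (T' : V) (q : T' ⟶ T) (a : T' ⟶ A i),
      IsRegularEpi q ∧ a ≫ r i = q ≫ y :=
    ⟨_, pullback.snd (r i) y, pullback.fst (r i) y, inferInstance, pullback.condition⟩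
  have lift_p {i : ι} {T : V} (y : T ⟶ M i) : ∃ (T' : V) (q : T' ⟶ T) (a : T' ⟶ X i),
      IsRegularEpi q ∧ a ≫ p i = q ≫ y :=
    ⟨_, pullback.snd (p i) y, pullback.fst (p i) y, inferInstance, pullback.condition⟩
  -- the action on `B`, on the universal elements
  have H (i j : ι) : ∃ b : pullback (t i ≫ c i) (c j) ⟶ B j,
      ∀ {T : V} (a : T ⟶ A i) (x : T ⟶ X j) (h : a ≫ s i ≫ p i ≫ c i = x ≫ p j ≫ c j)
        (h' : (a ≫ r i) ≫ t i ≫ c i = (x ≫ p j) ≫ c j),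
        pullback.lift (a ≫ r i) (x ≫ p j) h' ≫ b = α.act a x h ≫ r j := by
    -- On the cover `q₂ ≫ q₁` the two projections lift to `A i` and `X j`, where `α` acts. By
    -- `FamilyAction.exists_comp_eq` the result in `B j` does not depend on the lifts, so it
    -- descends.
    obtain ⟨N₁, q₁, a₁, _, ha₁⟩ := lift_r (pullback.fst (t i ≫ c i) (c j))
    obtain ⟨N₂, q₂, x₂, _, hx₂⟩ := lift_p (q₁ ≫ pullback.snd (t i ≫ c i) (c j))
    have hq : IsCovering (fun _ : Unit => q₂ ≫ q₁) :=
      (isCovering_of_isRegularEpi q₁).regularEpi_comp (fun _ => q₂)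
    have h₂ : (q₂ ≫ a₁) ≫ s i ≫ p i ≫ c i = x₂ ≫ p j ≫ c j := by
      rw [← Category.assoc (s i), h₀, reassoc_of% hx₂, ← pullback.condition, Category.assoc,
        Category.assoc, reassoc_of% ha₁]
    obtain ⟨b, hb, -⟩ := hq.existsUnique_desc (fun _ => α.act (q₂ ≫ a₁) x₂ h₂ ≫ r j)
      (fun _ _ U u u' hu => by
        rw [← Category.assoc, ← Category.assoc, α.comp_act (h' := by rw [Category.assoc, h₂,
          Category.assoc]), α.comp_act (h' := by rw [Category.assoc, h₂, Category.assoc])]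
        have h₃ := congrArg (· ≫ pullback.fst _ _) hu
        have h₄ := congrArg (· ≫ pullback.snd _ _) hu
        simp only [Category.assoc, ← ha₁, ← hx₂] at h₃ h₄
        exact α.exists_comp_eq hr (hα _) _ _ (by simpa using h₃) (by simpa using h₄))
    refine ⟨b, fun {T} a x h h' => ?_⟩
    -- An arbitrary lift `(a, x)` is compared with the chosen one after pulling back the cover,
    -- again by independence of lifts.
    refine hq.isUnivEpi (pullback.lift (a ≫ r i) (x ≫ p j) h') _ _ fun _ U u v huv => ?_
    rw [← Category.assoc v, ← huv, Category.assoc, hb ⟨⟩, ← Category.assoc, ← Category.assoc,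
      α.comp_act (h' := by rw [Category.assoc, h₂, Category.assoc]),
      α.comp_act (h' := by rw [Category.assoc, h, Category.assoc])]
    have h₃ := congrArg (· ≫ pullback.fst _ _) huv
    have h₄ := congrArg (· ≫ pullback.snd _ _) huv
    simp only [Category.assoc, ← ha₁, ← hx₂, pullback.lift_fst, pullback.lift_snd] at h₃ h₄
    exact α.exists_comp_eq hr (hα _) _ _ (by simpa using h₃) (by simpa using h₄)
  choose b hb using H
  have compat {i j : ι} {T T' : V} {y : T ⟶ B i} {m : T ⟶ M j} {q : T' ⟶ T} {a : T' ⟶ A i}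
      {x : T' ⟶ X j} (h : y ≫ t i ≫ c i = m ≫ c j) (ha : a ≫ r i = q ≫ y)
      (hx : x ≫ p j = q ≫ m) : a ≫ s i ≫ p i ≫ c i = x ≫ p j ≫ c j := by
    rw [← Category.assoc (s i), h₀, Category.assoc, reassoc_of% ha, h, reassoc_of% hx]
  have key {i j : ι} {T T' : V} {y : T ⟶ B i} {m : T ⟶ M j} {q : T' ⟶ T} {a : T' ⟶ A i}
      {x : T' ⟶ X j} (h : y ≫ t i ≫ c i = m ≫ c j) (ha : a ≫ r i = q ≫ y)
      (hx : x ≫ p j = q ≫ m) :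
      q ≫ pullback.lift y m h ≫ b i j = α.act a x (compat h ha hx) ≫ r j := by
    rw [← hb i j a x (compat h ha hx) (by rw [ha, hx, Category.assoc, Category.assoc, h]),
      ← Category.assoc]
    congr 1
    apply pullback.hom_ext <;> simp [pullback.lift_fst, pullback.lift_snd, ha, hx]
  -- Second stage: `B` inherits an action of the kernel pair of `c`. Its laws are tested on regular
  -- epimorphic covers where the arguments lift to `A` and `X`; there `key` turns them into laws of
  -- `α`.
  let β : FamilyAction c t :=
    { act {i j T} y m h := pullback.lift y m h ≫ b i j
      comp_act {i j T T'} f y m h h' := by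
        rw [← Category.assoc]
        congr 1
        apply pullback.hom_ext <;> simp [pullback.lift_fst, pullback.lift_snd]
      act_str {i j T} y m h := by
        obtain ⟨T₁, q₁, a, _, ha⟩ := lift_r y
        obtain ⟨T₂, q₂, x, _, hx⟩ := lift_p (q₁ ≫ m)
        rw [← cancel_epi q₁, ← cancel_epi q₂]
        have ha' : (q₂ ≫ a) ≫ r i = (q₂ ≫ q₁) ≫ y := by rw [Category.assoc, ha, Category.assoc]
        have hx' : x ≫ p j = (q₂ ≫ q₁) ≫ m := by rw [hx, Category.assoc]
        have h₁ := congrArg (· ≫ t j) (key h ha' hx')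
        simp only [Category.assoc, ← h₀, α.act_str_assoc] at h₁
        rw [Category.assoc, h₁, hx]
      act_unit {i T} y m h hy := by
        obtain ⟨T₁, q₁, a, _, ha⟩ := lift_r y
        have hx : (a ≫ s i) ≫ p i = q₁ ≫ m := by
          rw [Category.assoc, h₀, reassoc_of% ha, hy]
        rw [← cancel_epi q₁, key h ha hx, α.act_unit _ _ _ rfl, ha]
      act_act {i j k T} y m m' h h' h'' := by
        obtain ⟨T₁, q₁, a, _, ha⟩ := lift_r y
        obtain ⟨T₂, q₂, x, _, hx⟩ := lift_p (q₁ ≫ m)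
        obtain ⟨T₃, q₃, x', _, hx'⟩ := lift_p (q₂ ≫ q₁ ≫ m')
        rw [← cancel_epi q₁, ← cancel_epi q₂, ← cancel_epi q₃]
        have ea : (q₃ ≫ q₂ ≫ a) ≫ r i = (q₃ ≫ q₂ ≫ q₁) ≫ y := by
          simp only [Category.assoc, ha]
        have ex : (q₃ ≫ x) ≫ p j = (q₃ ≫ q₂ ≫ q₁) ≫ m := by simp only [Category.assoc, hx]
        have ex' : x' ≫ p k = (q₃ ≫ q₂ ≫ q₁) ≫ m' := by simp only [Category.assoc, hx']
        have h₁ := key h' (key h ea ex).symm ex'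
        have h₂ := key h'' ea ex'
        rw [α.act_act _ _ _ _ _ (compat h'' ea ex'), ← h₂] at h₁
        simpa only [Category.assoc] using h₁ }
  obtain ⟨E, ε, k, hk, hβ⟩ := hc t β
  refine ⟨E, ε, fun i => r i ≫ k i, fun i => ?_, fun {i j T} a x h => ?_⟩
  · exact (hr i).paste_horiz (hk i)
  · have h' : (a ≫ r i) ≫ t i ≫ c i = (x ≫ p j) ≫ c j := by
      rw [Category.assoc, ← Category.assoc (r i), ← h₀]
      simpa using h
    rw [← Category.assoc, ← Category.assoc, ← hβ (a ≫ r i) (x ≫ p j) h']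
    congr 1
    exact (hb i j a x h h').symm

end FamilyDescentComp

/-! ## Functors of enriched categories on hom-objects -/

section

variable {V : Type u} [Category.{v} V] [CartesianMonoidalCategory V]

open CartesianMonoidalCategory SemiCartesianMonoidalCategory

/-- Products commute with pullbacks; this is what makes the families of pairs and triples stable
under base change of `V`-functors. -/
lemma CategoryTheory.IsPullback.tensorHom {P X Y Z P' X' Y' Z' : V} {p : P ⟶ X} {q : P ⟶ Y}
    {f : X ⟶ Z} {g : Y ⟶ Z} {p' : P' ⟶ X'} {q' : P' ⟶ Y'} {f' : X' ⟶ Z'} {g' : Y' ⟶ Z'}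
    (h : IsPullback p q f g) (h' : IsPullback p' q' f' g') :
    IsPullback (p ⊗ₘ p') (q ⊗ₘ q') (f ⊗ₘ f') (g ⊗ₘ g') where
  w := by rw [tensorHom_comp_tensorHom, tensorHom_comp_tensorHom, h.w, h'.w]
  isLimit' := by
    refine ⟨PullbackCone.IsLimit.mk _
      (fun s => CartesianMonoidalCategory.lift
        (h.lift (s.fst ≫ fst _ _) (s.snd ≫ fst _ _) ?_)
        (h'.lift (s.fst ≫ snd _ _) (s.snd ≫ snd _ _) ?_))
      (fun s => ?_) (fun s => ?_) (fun s m h₁ h₂ => ?_)⟩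
    · simpa using congrArg (· ≫ fst _ _) s.condition
    · simpa using congrArg (· ≫ snd _ _) s.condition
    · rw [lift_map, h.lift_fst, h'.lift_fst, lift_comp_fst_snd]
    · rw [lift_map, h.lift_snd, h'.lift_snd, lift_comp_fst_snd]
    · apply CartesianMonoidalCategory.hom_ext
      · rw [CartesianMonoidalCategory.lift_fst]
        apply h.hom_ext
        · simp [← h₁]
        · simp [← h₂]
      · rw [CartesianMonoidalCategory.lift_snd]
        apply h'.hom_ext
        · simp [← h₁]
        · simp [← h₂]

namespace VCat

variable {C D E : VCat.{w} V}

/-- The hom-morphism of a `V`-functor, with codomain transported along equalities of objects. -/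
def homTo (F : C ⟶ D) {x x' : C} {y y' : D} (h : onObj F x = y) (h' : onObj F x' = y') :
    C.hom x x' ⟶ D.hom y y' :=
  onHom F x x' ≫ eqToHom (by rw [h, h'])

lemma homTo_rfl (F : C ⟶ D) (x x' : C) : homTo F (x := x) (x' := x') rfl rfl = onHom F x x' :=
  Category.comp_id _

lemma homTo_comp_homTo {F : C ⟶ D} {G : D ⟶ E} {K : C ⟶ E} (e : F ≫ G = K) {x x' : C} {y y' : D}
    {z z' : E} (h : onObj F x = y) (h' : onObj F x' = y') (k : onObj G y = z)
    (k' : onObj G y' = z') (l : onObj K x = z) (l' : onObj K x' = z') :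
    homTo F h h' ≫ homTo G k k' = homTo K l l' := by
  subst e h h' k k'
  rw [homTo_rfl, homTo_rfl]
  exact (homTo_rfl (F ≫ G) x x').symm

lemma homTo_comp_homTo_of_eq {E' : VCat.{w} V} {F : C ⟶ D} {G : D ⟶ E} {F' : C ⟶ E'} {G' : E' ⟶ E}
    (e : F ≫ G = F' ≫ G') {x x' : C} {y y' : D} {t t' : E'} {z z' : E} (h : onObj F x = y)
    (h' : onObj F x' = y') (k : onObj G y = z) (k' : onObj G y' = z') (m : onObj F' x = t)
    (m' : onObj F' x' = t') (n : onObj G' t = z) (n' : onObj G' t' = z') :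
    homTo F h h' ≫ homTo G k k' = homTo F' m m' ≫ homTo G' n n' := by
  have l : onObj (F' ≫ G') x = z := (congrArg (onObj G') m).trans n
  have l' : onObj (F' ≫ G') x' = z' := (congrArg (onObj G') m').trans n'
  exact (homTo_comp_homTo e h h' k k' l l').trans (homTo_comp_homTo rfl m m' n n' l l').symm

lemma homTo_eqToHom (F : C ⟶ D) {x x' : C} {y y' z z' : D} (h : onObj F x = y)
    (h' : onObj F x' = y') (k : onObj F x = z) (k' : onObj F x' = z')
    (e : D.hom y y' = D.hom z z') : homTo F h h' ≫ eqToHom e = homTo F k k' := by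
  unfold homTo
  rw [Category.assoc, eqToHom_trans]

lemma eId_homTo (F : C ⟶ D) {x : C} {y : D} (h h' : onObj F x = y) :
    eId V x ≫ homTo F h h' = eId V y := by
  subst h
  rw [homTo_rfl]
  exact EnrichedFunctor.map_id F x

lemma eComp_homTo (F : C ⟶ D) {x₀ x₁ x₂ : C} {y₀ y₁ y₂ : D} (h₀ : onObj F x₀ = y₀)
    (h₁ : onObj F x₁ = y₁) (h₂ : onObj F x₂ = y₂) :
    eComp V x₀ x₁ x₂ ≫ homTo F h₀ h₂ =
      (homTo F h₀ h₁ ⊗ₘ homTo F h₁ h₂) ≫ eComp V y₀ y₁ y₂ := by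
  subst h₀ h₁ h₂
  rw [homTo_rfl, homTo_rfl, homTo_rfl]
  exact EnrichedFunctor.map_comp F x₀ x₁ x₂

lemma functor_ext {F G : C ⟶ D} (ho : ∀ x, onObj F x = onObj G x)
    (hm : ∀ x x', homTo F (ho x) (ho x') = onHom G x x') : F = G :=
  EnrichedFunctor.ext V ho hm

lemma comp_eq_of_homTo {F : C ⟶ D} {G : D ⟶ E} {K : C ⟶ E}
    (ho : ∀ x, onObj G (onObj F x) = onObj K x)
    (hm : ∀ x x', onHom F x x' ≫ homTo G (ho x) (ho x') = onHom K x x') : F ≫ G = K := by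
  refine functor_ext ho fun x x' => ?_
  exact (homTo_comp_homTo rfl rfl rfl (ho x) (ho x') _ _).symm.trans
    ((congrArg (· ≫ _) (homTo_rfl F x x')).trans (hm x x'))

lemma isPullback_of_existsUnique {A : Type*} [Category A] {P X Y Z : A} {p : P ⟶ X} {q : P ⟶ Y}
    {f : X ⟶ Z} {g : Y ⟶ Z} (h : p ≫ f = q ≫ g)
    (H : ∀ {S : A} (a : S ⟶ X) (b : S ⟶ Y), a ≫ f = b ≫ g → ∃! d : S ⟶ P, d ≫ p = a ∧ d ≫ q = b) :
    IsPullback p q f g :=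
  ⟨⟨h⟩, ⟨PullbackCone.IsLimit.mk _ (fun s => (H _ _ s.condition).choose)
    (fun s => (H _ _ s.condition).choose_spec.1.1) (fun s => (H _ _ s.condition).choose_spec.1.2)
    (fun s m h₁ h₂ => (H _ _ s.condition).choose_spec.2 m ⟨h₁, h₂⟩)⟩⟩

/-- A commutative square of `V`-functors is a pullback if it is a pullback on objects and on
hom-objects. -/
lemma isPullback_of_hom {W : VCat.{w} V} {k : W ⟶ E} {f : W ⟶ C} {G : E ⟶ D} {F : C ⟶ D}
    (hw : k ≫ G = f ≫ F)
    (ho : ∀ (e : E) (x : C), onObj G e = onObj F x → ∃! w : W, onObj k w = e ∧ onObj f w = x)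
    (hh : ∀ (w w' : W) (h : onObj F (onObj f w) = onObj G (onObj k w))
      (h' : onObj F (onObj f w') = onObj G (onObj k w')),
      IsPullback (onHom k w w') (onHom f w w') (onHom G _ _) (homTo F h h')) :
    IsPullback k f G F := by
  have hF (w : W) : onObj F (onObj f w) = onObj G (onObj k w) :=
    congrArg (fun K : W ⟶ D => onObj K w) hw.symm
  -- `ext` and `exists_lift` restate the pullback property on homs with free names for the images of
  -- objects, so that the equalities can be removed by `subst`.
  have ext {w w' : W} {T : V} {a b : T ⟶ W.hom w w'} {e e' : E} {x x' : C}
      (h : onObj k w = e) (h' : onObj k w' = e') (l : onObj f w = x) (l' : onObj f w' = x')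
      (h₁ : a ≫ homTo k h h' = b ≫ homTo k h h') (h₂ : a ≫ homTo f l l' = b ≫ homTo f l l') :
      a = b := by
    subst h h' l l'
    rw [homTo_rfl] at h₁ h₂
    exact (hh w w' (hF w) (hF w')).hom_ext h₁ h₂
  have exists_lift {w w' : W} {T : V} {e e' : E} {x x' : C} {y y' : D}
      (h : onObj k w = e) (h' : onObj k w' = e') (l : onObj f w = x) (l' : onObj f w' = x')
      (m : onObj F x = y) (m' : onObj F x' = y') (n : onObj G e = y) (n' : onObj G e' = y')
      (a : T ⟶ E.hom e e') (b : T ⟶ C.hom x x') (hab : a ≫ homTo G n n' = b ≫ homTo F m m') :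
      ∃ c : T ⟶ W.hom w w', c ≫ homTo k h h' = a ∧ c ≫ homTo f l l' = b := by
    subst h h' l l' n n'
    rw [homTo_rfl] at hab
    rw [homTo_rfl, homTo_rfl]
    have hp := hh w w' (hF w) (hF w')
    exact ⟨hp.lift a b hab, hp.lift_fst _ _ _, hp.lift_snd _ _ _⟩
  refine isPullback_of_existsUnique hw fun {S} a b hab => ?_
  have hs (t : S) : onObj G (onObj a t) = onObj F (onObj b t) :=
    congrArg (fun K : S ⟶ D => onObj K t) hab
  choose o ho₁ ho₂ using fun t : S => (ho _ _ (hs t)).exists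
  have H (t t' : S) := exists_lift (ho₁ t) (ho₁ t') (ho₂ t) (ho₂ t') rfl rfl (hs t) (hs t')
    (homTo a rfl rfl : S.hom t t' ⟶ _) (homTo b rfl rfl)
    (homTo_comp_homTo_of_eq hab _ _ _ _ _ _ _ _)
  choose m hm₁ hm₂ using H
  let d : S ⟶ W :=
    { obj := o
      map := m
      map_id := fun t => by
        apply ext (ho₁ t) (ho₁ t) (ho₂ t) (ho₂ t)
        · rw [Category.assoc, hm₁, eId_homTo, eId_homTo]
        · rw [Category.assoc, hm₂, eId_homTo, eId_homTo]
      map_comp := fun t₀ t₁ t₂ => by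
        apply ext (ho₁ _) (ho₁ _) (ho₂ _) (ho₂ _)
        · rw [Category.assoc, hm₁, Category.assoc, eComp_homTo k (ho₁ t₀) (ho₁ t₁) (ho₁ t₂),
            tensorHom_comp_tensorHom_assoc, hm₁, hm₁, eComp_homTo]
        · rw [Category.assoc, hm₂, Category.assoc, eComp_homTo f (ho₂ t₀) (ho₂ t₁) (ho₂ t₂),
            tensorHom_comp_tensorHom_assoc, hm₂, hm₂, eComp_homTo] }
  refine ⟨d, ⟨?_, ?_⟩, fun d' ⟨hd₁, hd₂⟩ => ?_⟩
  · exact comp_eq_of_homTo ho₁ fun t t' => (hm₁ t t').trans (homTo_rfl a t t')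
  · exact comp_eq_of_homTo ho₂ fun t t' => (hm₂ t t').trans (homTo_rfl b t t')
  · have e₁ (t : S) : onObj k (onObj d' t) = onObj a t :=
      congrArg (fun K : S ⟶ E => onObj K t) hd₁
    have e₂ (t : S) : onObj f (onObj d' t) = onObj b t :=
      congrArg (fun K : S ⟶ C => onObj K t) hd₂
    have e (t : S) : onObj d' t = o t :=
      (ho _ _ (hs t)).unique ⟨e₁ t, e₂ t⟩ ⟨ho₁ t, ho₂ t⟩
    refine functor_ext e fun t t' => ?_
    change homTo d' (e t) (e t') = m t t'
    apply ext (ho₁ t) (ho₁ t') (ho₂ t) (ho₂ t')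
    · rw [homTo_comp_homTo hd₁ _ _ _ _ rfl rfl, hm₁]
    · rw [homTo_comp_homTo hd₂ _ _ _ _ rfl rfl, hm₂]

/-- The family of the hom-morphisms of `F` over `D(y₀, y₁)` is covering. -/
def CoversHoms (F : C ⟶ D) : Prop :=
  ∀ y₀ y₁ : D, IsCovering (fun q : Fiber F y₀ × Fiber F y₁ => homTo F q.1.2 q.2.2)

/-- The family of morphisms induced by `F` over `D(y₀, y₁) × D(y₁, y₂)` is covering. -/
def CoversPairs (F : C ⟶ D) : Prop :=
  ∀ y₀ y₁ y₂ : D, IsCovering (fun q : Fiber F y₀ × Fiber F y₁ × Fiber F y₂ =>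
    homTo F q.1.2 q.2.1.2 ⊗ₘ homTo F q.2.1.2 q.2.2.2)

/-- The family of morphisms induced by `F` over `D(y₀, y₁) × D(y₁, y₂) × D(y₂, y₃)` is universally
epimorphic. -/
def EpiTriples (F : C ⟶ D) : Prop :=
  ∀ y₀ y₁ y₂ y₃ : D, IsUnivEpi (fun q : Fiber F y₀ × Fiber F y₁ × Fiber F y₂ × Fiber F y₃ =>
    homTo F q.1.2 q.2.1.2 ⊗ₘ homTo F q.2.1.2 q.2.2.1.2 ⊗ₘ homTo F q.2.2.1.2 q.2.2.2.2)

/-- A `V`-functor that is surjective on objects, covers homs, and is epimorphic on pairs, is an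
effective epimorphism. -/
lemma existsUnique_desc [HasPullbacks V] {q : C ⟶ D} (hs : Function.Surjective (onObj q))
    (h₁ : CoversHoms q) (h₂ : CoversPairs q) {T : VCat.{w} V} (e : C ⟶ T)
    (he : ∀ {U : VCat.{w} V} (a b : U ⟶ C), a ≫ q = b ≫ q → a ≫ e = b ≫ e) :
    ∃! d : D ⟶ T, q ≫ d = e := by
  -- The kernel pair of `q` is the universal test: its objects show that `e` is constant on fibres,
  -- and generalized elements of its hom-objects show that `e` identifies what `q` identifies.
  have hc := he _ _ (pullback_condition q q)
  have ho {x x' : C} (h : onObj q x = onObj q x') : onObj e x = onObj e x' :=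
    congrArg (fun K : pullbackCat q q ⟶ T => onObj K (⟨(x, x'), h⟩ : PullbackObj q q)) hc
  have hm {x₀ x₁ x₀' x₁' : C} {y₀ y₁ : D} {t₀ t₁ : T} (k₀ : onObj q x₀ = y₀) (k₁ : onObj q x₁ = y₁)
      (k₀' : onObj q x₀' = y₀) (k₁' : onObj q x₁' = y₁) (l₀ : onObj e x₀ = t₀)
      (l₁ : onObj e x₁ = t₁) (l₀' : onObj e x₀' = t₀) (l₁' : onObj e x₁' = t₁)
      {U : V} (a : U ⟶ C.hom x₀ x₁) (b : U ⟶ C.hom x₀' x₁')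
      (hab : a ≫ homTo q k₀ k₁ = b ≫ homTo q k₀' k₁') :
      a ≫ homTo e l₀ l₁ = b ≫ homTo e l₀' l₁' := by
    subst k₀ k₁ l₀ l₁
    let r₀ : pullbackCat q q := (⟨(x₀, x₀'), k₀'.symm⟩ : PullbackObj q q)
    let r₁ : pullbackCat q q := (⟨(x₁, x₁'), k₁'.symm⟩ : PullbackObj q q)
    rw [homTo_rfl] at hab
    let c : U ⟶ (pullbackCat q q).hom r₀ r₁ := pullback.lift a b hab
    have h := homTo_comp_homTo_of_eq hc (x := r₀) (x' := r₁) rfl rfl rfl rfl rfl rfl l₀' l₁'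
    have c₁ : c ≫ homTo (pullbackFst q q) (x := r₀) (x' := r₁) rfl rfl = a :=
      (congrArg (c ≫ ·) (homTo_rfl _ _ _)).trans (pullback.lift_fst _ _ _)
    have c₂ : c ≫ homTo (pullbackSnd q q) (x := r₀) (x' := r₁) rfl rfl = b :=
      (congrArg (c ≫ ·) (homTo_rfl _ _ _)).trans (pullback.lift_snd _ _ _)
    exact (congrArg (· ≫ homTo e rfl rfl) c₁).symm.trans ((Category.assoc _ _ _).trans
      ((congrArg (c ≫ ·) h).trans ((Category.assoc _ _ _).symm.trans
        (congrArg (· ≫ homTo e l₀' l₁') c₂))))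
  -- The descended functor sends `y` to the value of `e` at a chosen preimage; the hom-morphisms of
  -- `e` are transported to these values before they are descended.
  choose s hs using hs
  have ho' {x : C} {y : D} (h : onObj q x = y) : onObj e x = onObj e (s y) := ho (h.trans (hs y).symm)
  have H (y₀ y₁ : D) := (h₁ y₀ y₁).existsUnique_desc
    (fun i => homTo e (ho' i.1.2) (ho' i.2.2)) (fun i j U a b hab => hm _ _ _ _ _ _ _ _ a b hab)
  choose m hm' _ using H
  have hm {x₀ x₁ : C} {y₀ y₁ : D} (k₀ : onObj q x₀ = y₀) (k₁ : onObj q x₁ = y₁) :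
    homTo q k₀ k₁ ≫ m y₀ y₁ = homTo e (ho' k₀) (ho' k₁) := hm' y₀ y₁ (⟨x₀, k₀⟩, ⟨x₁, k₁⟩)
  let d : D ⟶ T :=
    { obj := fun y => onObj e (s y)
      map := m
      map_id := fun y => by
        rw [← eId_homTo q (hs y) (hs y), Category.assoc, hm, eId_homTo]
      map_comp := fun y₀ y₁ y₂ => by
        refine (h₂ y₀ y₁ y₂).isUnivEpi.hom_ext fun i => ?_
        rw [← Category.assoc, ← eComp_homTo, Category.assoc, hm, tensorHom_comp_tensorHom_assoc,
          hm, hm]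
        exact eComp_homTo e _ _ _ }
  have hd : q ≫ d = e := by
    have h (x : C) : onObj d (onObj q x) = onObj e x := (ho' rfl).symm
    refine comp_eq_of_homTo h fun x x' => ?_
    have e₁ : homTo d (h x) (h x') = m _ _ ≫ eqToHom (congrArg₂ T.hom (h x) (h x')) := rfl
    rw [e₁, ← homTo_rfl, ← Category.assoc, hm, homTo_eqToHom e _ _ rfl rfl, homTo_rfl]
  refine ⟨d, hd, fun d' hd' => ?_⟩
  have h (y : D) : onObj d' y = onObj d y := by
    have := congrArg (fun K : C ⟶ T => onObj K (s y)) (hd'.trans hd.symm)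
    change onObj d' (onObj q (s y)) = onObj d (onObj q (s y)) at this
    rwa [hs] at this
  refine functor_ext h fun y y' => (h₁ y y').isUnivEpi.hom_ext fun i => ?_
  rw [← homTo_rfl d]
  exact homTo_comp_homTo_of_eq (hd'.trans hd.symm) _ _ _ _ _ _ _ _

end VCat

end

/-! ### Constructing a `V`-category from hom-objects that pull back to those of `W` -/

section

variable {V : Type u} [Category.{v} V] [CartesianMonoidalCategory V]

open CartesianMonoidalCategory SemiCartesianMonoidalCategory

namespace VCat

variable {C D W : VCat.{w} V}

/-- A family of objects `H e e'` over the hom-objects of `D`, indexed by the pairs of elements of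
a set `B` over the set of objects of `D`, whose pullbacks along the hom-morphisms of `F : C ⟶ D`
are the hom-objects of a `V`-category `W` over `C`. -/
structure HomPullback (F : C ⟶ D) (f : W ⟶ C) {B : Type w} (H : B → B → V) (π : B → D)
    (k : W → B) where
  obj_eq : ∀ {w : W} {e : B}, k w = e → onObj F (onObj f w) = π e
  exists_obj : ∀ (e : B) (x : C), onObj F x = π e → ∃ w : W, k w = e ∧ onObj f w = x
  ε : ∀ e e' : B, H e e' ⟶ D.hom (π e) (π e')
  κ : ∀ {w w' : W} {e e' : B}, k w = e → k w' = e' → (W.hom w w' ⟶ H e e')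
  isPullback : ∀ {w w' : W} {e e' : B} (h : k w = e) (h' : k w' = e'),
    IsPullback (κ h h') (onHom f w w') (ε e e') (homTo F (obj_eq h) (obj_eq h'))

namespace HomPullback

variable {F : C ⟶ D} {f : W ⟶ C} {B : Type w} {H : B → B → V} {π : B → D} {k : W → B}
  (P : HomPullback F f H π k)

include P in
lemma surjective (hF : Function.Surjective (onObj F)) : Function.Surjective k := fun e =>
  have ⟨x, hx⟩ := hF (π e)
  have ⟨w, hw, _⟩ := P.exists_obj e x hx
  ⟨w, hw⟩

/-- This family is the pullback along `ε e₀ e₁` of the one for `F`. No member is lost, because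
`exists_obj` places some `w` over `e` above every object of `C` lying over `π e`. -/
lemma isCovering_homs (hF : CoversHoms F) (e₀ e₁ : B) :
    IsCovering (fun q : {w // k w = e₀} × {w // k w = e₁} => P.κ q.1.2 q.2.2) := by
  have h : IsCovering (fun q : {w // k w = e₀} × {w // k w = e₁} =>
      homTo F (P.obj_eq q.1.2) (P.obj_eq q.2.2)) := by
    refine (hF (π e₀) (π e₁)).of_factors ?_
    rintro ⟨⟨x₀, h₀⟩, ⟨x₁, h₁⟩⟩
    obtain ⟨w₀, hw₀, rfl⟩ := P.exists_obj e₀ x₀ h₀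
    obtain ⟨w₁, hw₁, rfl⟩ := P.exists_obj e₁ x₁ h₁
    exact ⟨(⟨w₀, hw₀⟩, ⟨w₁, hw₁⟩), 𝟙 _, Category.id_comp _⟩
  exact h.of_isPullback fun q => (P.isPullback q.1.2 q.2.2).flip

lemma isCovering_pairs (hF : CoversPairs F) (e₀ e₁ e₂ : B) :
    IsCovering (fun q : {w // k w = e₀} × {w // k w = e₁} × {w // k w = e₂} =>
      P.κ q.1.2 q.2.1.2 ⊗ₘ P.κ q.2.1.2 q.2.2.2) := by
  have h : IsCovering (fun q : {w // k w = e₀} × {w // k w = e₁} × {w // k w = e₂} =>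
      homTo F (P.obj_eq q.1.2) (P.obj_eq q.2.1.2) ⊗ₘ
        homTo F (P.obj_eq q.2.1.2) (P.obj_eq q.2.2.2)) := by
    refine (hF (π e₀) (π e₁) (π e₂)).of_factors ?_
    rintro ⟨⟨x₀, h₀⟩, ⟨x₁, h₁⟩, ⟨x₂, h₂⟩⟩
    obtain ⟨w₀, hw₀, rfl⟩ := P.exists_obj e₀ x₀ h₀
    obtain ⟨w₁, hw₁, rfl⟩ := P.exists_obj e₁ x₁ h₁
    obtain ⟨w₂, hw₂, rfl⟩ := P.exists_obj e₂ x₂ h₂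
    exact ⟨(⟨w₀, hw₀⟩, ⟨w₁, hw₁⟩, ⟨w₂, hw₂⟩), 𝟙 _, Category.id_comp _⟩
  exact h.of_isPullback fun q =>
    ((P.isPullback q.1.2 q.2.1.2).tensorHom (P.isPullback q.2.1.2 q.2.2.2)).flip

lemma isUnivEpi_triples (hF : EpiTriples F) (e₀ e₁ e₂ e₃ : B) :
    IsUnivEpi (fun q : {w // k w = e₀} × {w // k w = e₁} × {w // k w = e₂} × {w // k w = e₃} =>
      P.κ q.1.2 q.2.1.2 ⊗ₘ P.κ q.2.1.2 q.2.2.1.2 ⊗ₘ P.κ q.2.2.1.2 q.2.2.2.2) := by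
  have h : IsUnivEpi
      (fun q : {w // k w = e₀} × {w // k w = e₁} × {w // k w = e₂} × {w // k w = e₃} =>
      homTo F (P.obj_eq q.1.2) (P.obj_eq q.2.1.2) ⊗ₘ
        homTo F (P.obj_eq q.2.1.2) (P.obj_eq q.2.2.1.2) ⊗ₘ
          homTo F (P.obj_eq q.2.2.1.2) (P.obj_eq q.2.2.2.2)) := by
    refine (hF (π e₀) (π e₁) (π e₂) (π e₃)).of_factors ?_
    rintro ⟨⟨x₀, h₀⟩, ⟨x₁, h₁⟩, ⟨x₂, h₂⟩, ⟨x₃, h₃⟩⟩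
    obtain ⟨w₀, hw₀, rfl⟩ := P.exists_obj e₀ x₀ h₀
    obtain ⟨w₁, hw₁, rfl⟩ := P.exists_obj e₁ x₁ h₁
    obtain ⟨w₂, hw₂, rfl⟩ := P.exists_obj e₂ x₂ h₂
    obtain ⟨w₃, hw₃, rfl⟩ := P.exists_obj e₃ x₃ h₃
    exact ⟨(⟨w₀, hw₀⟩, ⟨w₁, hw₁⟩, ⟨w₂, hw₂⟩, ⟨w₃, hw₃⟩), 𝟙 _, Category.id_comp _⟩
  exact h.of_isPullback fun q =>
    ((P.isPullback q.1.2 q.2.1.2).tensorHom ((P.isPullback q.2.1.2 q.2.2.1.2).tensorHom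
      (P.isPullback q.2.2.1.2 q.2.2.2.2))).flip

/-- If the identities and compositions of `W` are compatible with the projections to the `H e e'`,
then these are the hom-objects of a `V`-category over `D`, whose pullback along `F` is `W`. -/
lemma exists_isPullback (hs : Function.Surjective (onObj F)) (h₁ : CoversHoms F)
    (h₂ : CoversPairs F) (h₃ : EpiTriples F)
    (hk : ∀ w w' : W, k w = k w' → onObj f w = onObj f w' → w = w')
    (hid : ∀ {w w' : W} {e : B} (h : k w = e) (h' : k w' = e),
      eId V w ≫ P.κ h h = eId V w' ≫ P.κ h' h')
    (hcomp : ∀ {w₀ w₁ w₂ w₀' w₁' w₂' : W} {e₀ e₁ e₂ : B} (l₀ : k w₀ = e₀) (l₁ : k w₁ = e₁)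
      (l₂ : k w₂ = e₂) (l₀' : k w₀' = e₀) (l₁' : k w₁' = e₁) (l₂' : k w₂' = e₂) {U : V}
      (a : U ⟶ W.hom w₀ w₁ ⊗ W.hom w₁ w₂) (b : U ⟶ W.hom w₀' w₁' ⊗ W.hom w₁' w₂'),
      a ≫ (P.κ l₀ l₁ ⊗ₘ P.κ l₁ l₂) = b ≫ (P.κ l₀' l₁' ⊗ₘ P.κ l₁' l₂') →
      a ≫ eComp V w₀ w₁ w₂ ≫ P.κ l₀ l₂ = b ≫ eComp V w₀' w₁' w₂' ≫ P.κ l₀' l₂') :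
    ∃ (E : VCat.{w} V) (G : E ⟶ D) (k' : W ⟶ E), IsPullback k' f G F ∧
      ∀ {S : VCat.{w} V} (a b : S ⟶ W) (ho : ∀ s, k (onObj a s) = k (onObj b s)),
        (∀ s s', onHom a s s' ≫ P.κ (ho s) (ho s') = onHom b s s' ≫ P.κ rfl rfl) →
        a ≫ k' = b ≫ k' := by
  -- The identity at `e` is that of a chosen representative `s e`; `hid` makes it independent of the
  -- choice.
  choose s hs using P.surjective hs
  have hi {w : W} {e : B} (h : k w = e) : eId V w ≫ P.κ h h = eId V (s e) ≫ P.κ (hs e) (hs e) :=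
    hid h (hs e)
  -- Composition of `W`, followed by the projection to `H`, descends along the covering by pairs;
  -- `hcomp` is the compatibility that this requires.
  have H₂ (e₀ e₁ e₂ : B) := (P.isCovering_pairs h₂ e₀ e₁ e₂).existsUnique_desc
    (fun q => eComp V q.1.1 q.2.1.1 q.2.2.1 ≫ P.κ q.1.2 q.2.2.2)
    (fun q r U a b hab => hcomp _ _ _ _ _ _ a b hab)
  choose c hc' _ using H₂
  have hc {w₀ w₁ w₂ : W} {e₀ e₁ e₂ : B} (l₀ : k w₀ = e₀) (l₁ : k w₁ = e₁) (l₂ : k w₂ = e₂) :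
      (P.κ l₀ l₁ ⊗ₘ P.κ l₁ l₂) ≫ c e₀ e₁ e₂ = eComp V w₀ w₁ w₂ ≫ P.κ l₀ l₂ :=
    hc' e₀ e₁ e₂ (⟨w₀, l₀⟩, ⟨w₁, l₁⟩, ⟨w₂, l₂⟩)
  let str : EnrichedCategory V B :=
    { Hom := H
      id := fun e => eId V (s e) ≫ P.κ (hs e) (hs e)
      comp := c
      id_comp := fun e e' => by
        refine (P.isCovering_homs h₁ e e').isUnivEpi.hom_ext fun ⟨⟨w, h⟩, ⟨w', h'⟩⟩ => ?_
        rw [leftUnitor_inv_naturality_assoc, ← hi h, comp_whiskerRight, Category.assoc,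
          whisker_exchange_assoc, whisker_exchange_assoc, ← tensorHom_def_assoc, hc,
          Category.comp_id, e_id_comp_assoc]
      comp_id := fun e e' => by
        refine (P.isCovering_homs h₁ e e').isUnivEpi.hom_ext fun ⟨⟨w, h⟩, ⟨w', h'⟩⟩ => ?_
        rw [rightUnitor_inv_naturality_assoc, ← hi h', MonoidalCategory.whiskerLeft_comp,
          Category.assoc, ← whisker_exchange_assoc, ← whisker_exchange_assoc,
          ← tensorHom_def'_assoc, hc, Category.comp_id, e_comp_id_assoc]
      -- Only an equation has to be descended here, so a jointly epimorphic family of triples is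
      -- enough; on it the law becomes associativity in `W`.
      assoc := fun e₀ e₁ e₂ e₃ => by
        refine (P.isUnivEpi_triples h₃ e₀ e₁ e₂ e₃).hom_ext
          fun ⟨⟨w₀, l₀⟩, ⟨w₁, l₁⟩, ⟨w₂, l₂⟩, ⟨w₃, l₃⟩⟩ => ?_
        dsimp only
        rw [associator_inv_naturality_assoc, ← tensorHom_id, ← id_tensorHom,
          tensorHom_comp_tensorHom_assoc, tensorHom_comp_tensorHom_assoc, hc, hc,
          Category.comp_id, Category.comp_id, ← Category.id_comp (P.κ l₀ l₁),
          ← Category.id_comp (P.κ l₂ l₃), ← tensorHom_comp_tensorHom_assoc,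
          ← tensorHom_comp_tensorHom_assoc, hc, hc, tensorHom_id, id_tensorHom, e_assoc_assoc] }
  let E : VCat.{w} V := ⟨B⟩
  have hε {w w' : W} {e e' : B} (h : k w = e) (h' : k w' = e') :
      P.κ h h' ≫ P.ε e e' = onHom f w w' ≫ homTo F (P.obj_eq h) (P.obj_eq h') :=
    (P.isPullback h h').w
  let G : E ⟶ D :=
    { obj := π
      map := P.ε
      map_id := fun e => by
        change (eId V (s e) ≫ P.κ (hs e) (hs e)) ≫ P.ε e e = _
        rw [Category.assoc, hε, ← homTo_rfl, ← Category.assoc, eId_homTo f rfl rfl, eId_homTo]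
      map_comp := fun e₀ e₁ e₂ => by
        refine (P.isCovering_pairs h₂ e₀ e₁ e₂).isUnivEpi.hom_ext
          fun ⟨⟨w₀, l₀⟩, ⟨w₁, l₁⟩, ⟨w₂, l₂⟩⟩ => ?_
        change (P.κ l₀ l₁ ⊗ₘ P.κ l₁ l₂) ≫ c e₀ e₁ e₂ ≫ P.ε e₀ e₂ =
          (P.κ l₀ l₁ ⊗ₘ P.κ l₁ l₂) ≫ (P.ε e₀ e₁ ⊗ₘ P.ε e₁ e₂) ≫ eComp V (π e₀) (π e₁) (π e₂)
        rw [← Category.assoc, hc, Category.assoc, hε, tensorHom_comp_tensorHom_assoc, hε, hε,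
          ← homTo_rfl, ← Category.assoc, eComp_homTo f rfl rfl rfl, Category.assoc,
          eComp_homTo F _ (P.obj_eq l₁) _, tensorHom_comp_tensorHom_assoc, homTo_rfl, homTo_rfl] }
  let k' : W ⟶ E :=
    { obj := k
      map := fun w w' => P.κ rfl rfl
      map_id := fun w => hi rfl
      map_comp := fun w₀ w₁ w₂ => (hc rfl rfl rfl).symm }
  have hk' {w w' : W} {e e' : E} (h : k w = e) (h' : k w' = e') : homTo k' h h' = P.κ h h' := by
    subst h h'
    exact homTo_rfl k' w w'
  refine ⟨E, G, k', isPullback_of_hom ?_ (fun e x hex => ?_) (fun w w' h h' => ?_), ?_⟩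
  · refine (comp_eq_of_homTo (fun w => P.obj_eq rfl) fun w w' => ?_).symm
    exact (hε rfl rfl).symm
  · obtain ⟨w, hw⟩ := P.exists_obj e x hex.symm
    exact ⟨w, hw, fun w' hw' => hk _ _ (hw'.1.trans hw.1.symm) (hw'.2.trans hw.2.symm)⟩
  · exact P.isPullback rfl rfl
  · intro S a b ho hm
    exact comp_eq_of_homTo ho fun t t' =>
      (congrArg (onHom a t t' ≫ ·) (hk' _ _)).trans (hm t t')

end HomPullback

end VCat

end

/-! ### From descent data to actions on generalized elements -/

section

variable {V : Type u} [Category.{v} V]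

/-- The action on generalized elements defined by a descent datum. -/
noncomputable def DescentDatum.pointAction [HasPullbacks V] {X Y : V} {p : X ⟶ Y}
    (A : DescentDatum p) : PointAction p A.str where
  act a x h := pullback.lift a x h ≫ A.act
  comp_act t a x h h' := by
    rw [← Category.assoc]
    congr 1
    apply pullback.hom_ext <;> simp [pullback.lift_fst, pullback.lift_snd]
  act_str a x h := by rw [Category.assoc, A.act_str, pullback.lift_snd]
  act_unit a x h hx := by
    subst hx
    have h' := congrArg (a ≫ ·) A.act_unit
    rw [← Category.assoc, Category.comp_id] at h'
    refine Eq.trans ?_ h'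
    congr 1
    apply pullback.hom_ext <;> simp [pullback.lift_fst, pullback.lift_snd]
  act_act {T} a x x' h h' h'' := by
    have hc : pullback.lift a x h ≫ pullback.snd (A.str ≫ p) p ≫ p = x' ≫ p := by
      rw [pullback.lift_snd_assoc, ← h, h'']
    have e := congrArg (fun t => pullback.lift (pullback.lift a x h) x' hc ≫ t) A.act_assoc
    refine Eq.trans ?_ (((Category.assoc _ _ _).trans (e.trans (Category.assoc _ _ _).symm)).trans ?_)
    · congr 1
      apply pullback.hom_ext <;>
        simp [pullback.lift_fst, pullback.lift_snd, pullback.lift_fst_assoc]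
    · congr 1
      apply pullback.hom_ext <;>
        simp [pullback.lift_fst, pullback.lift_snd, pullback.lift_fst_assoc]

variable [CartesianMonoidalCategory V] [HasPullbacks V]

open CartesianMonoidalCategory SemiCartesianMonoidalCategory

namespace VCat

/-! ### Generalized elements of hom-objects of a pullback -/

section PullbackElements

variable {C D E : VCat.{w} V} {F : C ⟶ D} {G : E ⟶ D}

/-- An object of the pullback of `V`-functors. -/
def pairObj {x : C} {y : E} (h : onObj F x = onObj G y) : pullbackCat F G :=
  (⟨(x, y), h⟩ : PullbackObj F G)

variable {x₀ x₁ x₂ : C} {y₀ y₁ y₂ : E} {h₀ : onObj F x₀ = onObj G y₀} {h₁ : onObj F x₁ = onObj G y₁}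
  {h₂ : onObj F x₂ = onObj G y₂}

/-- The first projection on hom-objects of the pullback of `V`-functors. -/
noncomputable def pairFst (h₀ : onObj F x₀ = onObj G y₀) (h₁ : onObj F x₁ = onObj G y₁) :
    (pullbackCat F G).hom (pairObj h₀) (pairObj h₁) ⟶ C.hom x₀ x₁ :=
  homTo (pullbackFst F G) rfl rfl

/-- The second projection on hom-objects of the pullback of `V`-functors. -/
noncomputable def pairSnd (h₀ : onObj F x₀ = onObj G y₀) (h₁ : onObj F x₁ = onObj G y₁) :
    (pullbackCat F G).hom (pairObj h₀) (pairObj h₁) ⟶ E.hom y₀ y₁ :=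
  homTo (pullbackSnd F G) rfl rfl

lemma isPullback_pair (h₀ : onObj F x₀ = onObj G y₀) (h₁ : onObj F x₁ = onObj G y₁) {z₀ z₁ : D}
    (k₀ : onObj F x₀ = z₀) (k₁ : onObj F x₁ = z₁) (l₀ : onObj G y₀ = z₀) (l₁ : onObj G y₁ = z₁) :
    IsPullback (pairFst h₀ h₁) (pairSnd h₀ h₁) (homTo F k₀ k₁) (homTo G l₀ l₁) := by
  subst k₀ k₁
  rw [homTo_rfl]
  have e₁ : pairFst h₀ h₁ = pullback.fst (onHom F x₀ x₁) (homTo G l₀ l₁) := homTo_rfl _ _ _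
  have e₂ : pairSnd h₀ h₁ = pullback.snd (onHom F x₀ x₁) (homTo G l₀ l₁) := homTo_rfl _ _ _
  rw [e₁, e₂]
  exact IsPullback.of_hasPullback _ _

/-- Generalized elements of the hom-objects of the pullback of `V`-functors. -/
noncomputable def pairHom {T : V} (a : T ⟶ C.hom x₀ x₁) (b : T ⟶ E.hom y₀ y₁)
    (hab : a ≫ homTo F h₀ h₁ = b ≫ homTo G rfl rfl) :
    T ⟶ (pullbackCat F G).hom (pairObj h₀) (pairObj h₁) :=
  (isPullback_pair h₀ h₁ h₀ h₁ rfl rfl).lift a b hab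

@[simp]
lemma pairHom_fst {T : V} (a : T ⟶ C.hom x₀ x₁) (b : T ⟶ E.hom y₀ y₁)
    (hab : a ≫ homTo F h₀ h₁ = b ≫ homTo G rfl rfl) : pairHom a b hab ≫ pairFst h₀ h₁ = a :=
  IsPullback.lift_fst _ _ _ _

@[simp]
lemma pairHom_snd {T : V} (a : T ⟶ C.hom x₀ x₁) (b : T ⟶ E.hom y₀ y₁)
    (hab : a ≫ homTo F h₀ h₁ = b ≫ homTo G rfl rfl) : pairHom a b hab ≫ pairSnd h₀ h₁ = b :=
  IsPullback.lift_snd _ _ _ _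

lemma pair_hom_ext {T : V} {c d : T ⟶ (pullbackCat F G).hom (pairObj h₀) (pairObj h₁)}
    (hf : c ≫ pairFst h₀ h₁ = d ≫ pairFst h₀ h₁) (hs : c ≫ pairSnd h₀ h₁ = d ≫ pairSnd h₀ h₁) :
    c = d :=
  (isPullback_pair h₀ h₁ h₀ h₁ rfl rfl).hom_ext hf hs

lemma eId_pairFst : eId V (pairObj h₀) ≫ pairFst h₀ h₀ = eId V x₀ := eId_homTo _ _ _

lemma eId_pairSnd : eId V (pairObj h₀) ≫ pairSnd h₀ h₀ = eId V y₀ := eId_homTo _ _ _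

lemma eComp_pairFst : eComp V (pairObj h₀) (pairObj h₁) (pairObj h₂) ≫ pairFst h₀ h₂ =
    (pairFst h₀ h₁ ⊗ₘ pairFst h₁ h₂) ≫ eComp V x₀ x₁ x₂ := eComp_homTo _ _ _ _

lemma eComp_pairSnd : eComp V (pairObj h₀) (pairObj h₁) (pairObj h₂) ≫ pairSnd h₀ h₂ =
    (pairSnd h₀ h₁ ⊗ₘ pairSnd h₁ h₂) ≫ eComp V y₀ y₁ y₂ := eComp_homTo _ _ _ _

/-- A pair whose components both come from one element `z` is the image of `z` under the induced
functor. This turns equations between `V`-functors into equations between generalized elements of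
hom-objects. -/
lemma pairHom_homTo {S X : VCat.{w} V} {A : S ⟶ C} {B : S ⟶ E} (h : A ≫ F = B ≫ G)
    {K : pullbackCat F G ⟶ X} {L : S ⟶ X} (e : pullbackLift A B h ≫ K = L) {s t : S} {T : V}
    (z : T ⟶ S.hom s t) (a₀ : onObj A s = x₀) (a₁ : onObj A t = x₁) (b₀ : onObj B s = y₀)
    (b₁ : onObj B t = y₁) {a : T ⟶ C.hom x₀ x₁} {b : T ⟶ E.hom y₀ y₁}
    (ha : z ≫ homTo A a₀ a₁ = a) (hb : z ≫ homTo B b₀ b₁ = b)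
    (hab : a ≫ homTo F h₀ h₁ = b ≫ homTo G rfl rfl) {w₀ w₁ : X}
    (k₀ : onObj K (pairObj h₀) = w₀) (k₁ : onObj K (pairObj h₁) = w₁)
    (l₀ : onObj L s = w₀) (l₁ : onObj L t = w₁) :
    pairHom a b hab ≫ homTo K k₀ k₁ = z ≫ homTo L l₀ l₁ := by
  subst a₀ a₁ b₀ b₁
  have m₀ : onObj (pullbackLift A B h) s = pairObj h₀ := rfl
  have m₁ : onObj (pullbackLift A B h) t = pairObj h₁ := rfl
  have hz : pairHom a b hab = z ≫ homTo (pullbackLift A B h) m₀ m₁ := by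
    apply pair_hom_ext
    · rw [pairHom_fst, Category.assoc, ← ha]
      exact (congrArg (z ≫ ·) (homTo_comp_homTo (pullbackLift_fst A B h) m₀ m₁ rfl rfl _ _)).symm
    · rw [pairHom_snd, Category.assoc, ← hb]
      exact (congrArg (z ≫ ·) (homTo_comp_homTo (pullbackLift_snd A B h) m₀ m₁ rfl rfl _ _)).symm
  rw [hz, Category.assoc, homTo_comp_homTo e m₀ m₁ k₀ k₁ l₀ l₁]

end PullbackElements

/-! ### The action on objects and on hom-objects -/

section Action

variable {C D : VCat.{w} V} {F : C ⟶ D} {W : VCat.{w} V} {f : W ⟶ C} (α : PointAction F f)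

namespace ActionElements

/-- The action as a `V`-functor on the pullback. -/
noncomputable def functor : pullbackCat (f ≫ F) F ⟶ W :=
  α.act (pullbackFst (f ≫ F) F) (pullbackSnd (f ≫ F) F) (pullback_condition _ _)

lemma functor_str : functor α ≫ f = pullbackSnd (f ≫ F) F := α.act_str _ _ _

lemma comp_functor {S : VCat.{w} V} (t : S ⟶ pullbackCat (f ≫ F) F)
    (h : (t ≫ pullbackFst (f ≫ F) F) ≫ f ≫ F = (t ≫ pullbackSnd (f ≫ F) F) ≫ F) :
    t ≫ functor α = α.act (t ≫ pullbackFst (f ≫ F) F) (t ≫ pullbackSnd (f ≫ F) F) h :=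
  α.comp_act _ _ _ _ _

lemma unit_functor : pullbackLift (F := f ≫ F) (G := F) (𝟙 W) f (Category.id_comp _) ≫ functor α =
    𝟙 W :=
  (α.comp_act_eq _ _ (pullbackLift_fst _ _ _) (pullbackLift_snd _ _ _) (Category.id_comp _)).trans
    (α.act_unit _ _ _ (Category.id_comp f))

/-- Associativity of the action, as an equation of `V`-functors that can be evaluated both at
objects and at elements of hom-objects. -/
lemma functor_functor {S : VCat.{w} V} (a : S ⟶ pullbackCat (f ≫ F) F) (x : S ⟶ C)
    (h : (a ≫ functor α) ≫ f ≫ F = x ≫ F) (h' : (a ≫ pullbackFst (f ≫ F) F) ≫ f ≫ F = x ≫ F) :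
    pullbackLift (F := f ≫ F) (G := F) (a ≫ functor α) x h ≫ functor α =
      pullbackLift (F := f ≫ F) (G := F) (a ≫ pullbackFst (f ≫ F) F) x h' ≫ functor α := by
  have h'' : (a ≫ pullbackFst (f ≫ F) F) ≫ f ≫ F = (a ≫ pullbackSnd (f ≫ F) F) ≫ F := by
    rw [Category.assoc, pullback_condition, Category.assoc]
  have e : a ≫ functor α = α.act _ _ h'' := comp_functor α a h''
  refine (α.comp_act_eq _ _ ((pullbackLift_fst _ _ _).trans e) (pullbackLift_snd _ _ _)
    (e ▸ h)).trans ?_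
  refine Eq.trans ?_ (α.comp_act_eq _ _ (pullbackLift_fst _ _ _) (pullbackLift_snd _ _ _) h').symm
  exact α.act_act _ _ _ _ _ _

/-- The action on objects. -/
noncomputable def obj {w : W} {x : C} (h : onObj (f ≫ F) w = onObj F x) : W :=
  onObj (functor α) (pairObj h)

lemma obj_str {w : W} {x : C} (h : onObj (f ≫ F) w = onObj F x) : onObj f (obj α h) = x :=
  congrArg (fun K : pullbackCat (f ≫ F) F ⟶ C => onObj K (pairObj h)) (functor_str α)

lemma obj_unit (w : W) : obj α (x := onObj f w) (w := w) rfl = w :=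
  congrArg (fun K : W ⟶ W => onObj K w) (unit_functor α)

/-- The pullback carrying the iterated action. -/
noncomputable abbrev iterated (f : W ⟶ C) (F : C ⟶ D) : VCat.{w} V :=
  pullbackCat (pullbackSnd (f ≫ F) F ≫ F) F

lemma iterated_condition : (pullbackFst (pullbackSnd (f ≫ F) F ≫ F) F ≫ functor α) ≫ f ≫ F =
    pullbackSnd (pullbackSnd (f ≫ F) F ≫ F) F ≫ F := by
  rw [← pullback_condition (pullbackSnd (f ≫ F) F ≫ F) F, Category.assoc, ← Category.assoc (functor α),
    functor_str]

lemma iterated_condition' : (pullbackFst (pullbackSnd (f ≫ F) F ≫ F) F ≫ pullbackFst (f ≫ F) F) ≫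
    f ≫ F = pullbackSnd (pullbackSnd (f ≫ F) F ≫ F) F ≫ F := by
  rw [← pullback_condition (pullbackSnd (f ≫ F) F ≫ F) F, Category.assoc,
    pullback_condition (f ≫ F) F]

lemma obj_obj {w : W} {x x' : C} (h : onObj (f ≫ F) w = onObj F x)
    (h' : onObj (f ≫ F) (obj α h) = onObj F x') (h'' : onObj (f ≫ F) w = onObj F x') :
    obj α h' = obj α h'' := by
  have e : onObj (pullbackSnd (f ≫ F) F ≫ F) (pairObj h) = onObj F x' := h.symm.trans h''
  exact congrArg (fun K : iterated f F ⟶ W => onObj K (pairObj e))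
    (functor_functor α _ _ (iterated_condition α) iterated_condition')

variable {w₀ w₁ w₂ w₀' w₁' w₂' : W} {x₀ x₁ x₂ : C} {T : V}

/-- The action on generalized elements of hom-objects. -/
noncomputable def hom {h₀ : onObj (f ≫ F) w₀ = onObj F x₀} {h₁ : onObj (f ≫ F) w₁ = onObj F x₁}
    (k₀ : obj α h₀ = w₀') (k₁ : obj α h₁ = w₁') (a : T ⟶ W.hom w₀ w₁) (x : T ⟶ C.hom x₀ x₁)
    (h : a ≫ homTo (f ≫ F) h₀ h₁ = x ≫ homTo F rfl rfl) : T ⟶ W.hom w₀' w₁' :=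
  pairHom a x h ≫ homTo (functor α) k₀ k₁

variable {h₀ : onObj (f ≫ F) w₀ = onObj F x₀} {h₁ : onObj (f ≫ F) w₁ = onObj F x₁}
  {h₂ : onObj (f ≫ F) w₂ = onObj F x₂} (k₀ : obj α h₀ = w₀') (k₁ : obj α h₁ = w₁')
  (k₂ : obj α h₂ = w₂')

lemma hom_str (a : T ⟶ W.hom w₀ w₁) (x : T ⟶ C.hom x₀ x₁)
    (h : a ≫ homTo (f ≫ F) h₀ h₁ = x ≫ homTo F rfl rfl) (l₀ : onObj f w₀' = x₀)
    (l₁ : onObj f w₁' = x₁) : hom α k₀ k₁ a x h ≫ homTo f l₀ l₁ = x := by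
  unfold hom
  rw [Category.assoc, homTo_comp_homTo (functor_str α) k₀ k₁ l₀ l₁ rfl rfl]
  exact pairHom_snd _ _ _

lemma comp_hom {T' : V} (t : T' ⟶ T) (a : T ⟶ W.hom w₀ w₁) (x : T ⟶ C.hom x₀ x₁)
    (h : a ≫ homTo (f ≫ F) h₀ h₁ = x ≫ homTo F rfl rfl)
    (h' : (t ≫ a) ≫ homTo (f ≫ F) h₀ h₁ = (t ≫ x) ≫ homTo F rfl rfl) :
    t ≫ hom α k₀ k₁ a x h = hom α k₀ k₁ (t ≫ a) (t ≫ x) h' := by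
  unfold hom
  rw [← Category.assoc]
  congr 1
  apply pair_hom_ext <;> simp

lemma hom_unit {x₀ x₁ : C} (l₀ : onObj f w₀ = x₀) (l₁ : onObj f w₁ = x₁)
    {h₀ : onObj (f ≫ F) w₀ = onObj F x₀} {h₁ : onObj (f ≫ F) w₁ = onObj F x₁}
    (k₀ : obj α h₀ = w₀) (k₁ : obj α h₁ = w₁) (a : T ⟶ W.hom w₀ w₁) (x : T ⟶ C.hom x₀ x₁)
    (h : a ≫ homTo (f ≫ F) h₀ h₁ = x ≫ homTo F rfl rfl) (hx : a ≫ homTo f l₀ l₁ = x) :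
    hom α k₀ k₁ a x h = a := by
  have ha : a ≫ homTo (𝟙 W) (x := w₀) (x' := w₁) rfl rfl = a :=
    (congrArg (a ≫ ·) (homTo_rfl (𝟙 W) w₀ w₁)).trans (Category.comp_id _)
  exact (pairHom_homTo (A := 𝟙 W) (B := f) (Category.id_comp _) (unit_functor α) a
    (x₀ := w₀) (x₁ := w₁) rfl rfl l₀ l₁ ha hx h k₀ k₁ rfl rfl).trans ha

/-- The triple `(a, x, x')` is a single element `z` of a hom-object of `iterated f F`. The two
functors equated by `functor_functor` take at `z` the two sides, as `pairHom_homTo` shows. -/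
lemma hom_hom {w₀'' w₁'' : W} {x₀' x₁' : C} {h₀' : onObj (f ≫ F) w₀' = onObj F x₀'}
    {h₁' : onObj (f ≫ F) w₁' = onObj F x₁'} {h₀'' : onObj (f ≫ F) w₀ = onObj F x₀'}
    {h₁'' : onObj (f ≫ F) w₁ = onObj F x₁'} (k₀' : obj α h₀' = w₀'') (k₁' : obj α h₁' = w₁'')
    (k₀'' : obj α h₀'' = w₀'') (k₁'' : obj α h₁'' = w₁'')
    (a : T ⟶ W.hom w₀ w₁) (x : T ⟶ C.hom x₀ x₁) (x' : T ⟶ C.hom x₀' x₁')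
    (h : a ≫ homTo (f ≫ F) h₀ h₁ = x ≫ homTo F rfl rfl)
    (h' : hom α k₀ k₁ a x h ≫ homTo (f ≫ F) h₀' h₁' = x' ≫ homTo F rfl rfl)
    (h'' : a ≫ homTo (f ≫ F) h₀'' h₁'' = x' ≫ homTo F rfl rfl) :
    hom α k₀' k₁' (hom α k₀ k₁ a x h) x' h' = hom α k₀'' k₁'' a x' h'' := by
  have e₀ : onObj F x₀ = onObj F x₀' := h₀.symm.trans h₀''
  have e₁ : onObj F x₁ = onObj F x₁' := h₁.symm.trans h₁''
  have h₃ : a ≫ homTo (f ≫ F) h₀'' h₁'' = x ≫ homTo F e₀ e₁ := by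
    rw [← homTo_eqToHom (f ≫ F) h₀ h₁ h₀'' h₁'' (congrArg₂ D.hom e₀ e₁),
      ← homTo_eqToHom F rfl rfl e₀ e₁ (congrArg₂ D.hom e₀ e₁), ← Category.assoc, h,
      Category.assoc]
  have e₀' : onObj (pullbackSnd (f ≫ F) F ≫ F) (pairObj h₀) = onObj F x₀' := e₀
  have e₁' : onObj (pullbackSnd (f ≫ F) F ≫ F) (pairObj h₁) = onObj F x₁' := e₁
  have hz : pairHom a x h ≫ homTo (pullbackSnd (f ≫ F) F ≫ F) e₀' e₁' = x' ≫ homTo F rfl rfl :=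
    (congrArg (pairHom a x h ≫ ·) (homTo_comp_homTo (F := pullbackSnd (f ≫ F) F) rfl
      (x := pairObj h₀) (x' := pairObj h₁) rfl rfl e₀ e₁ e₀' e₁')).symm.trans
      ((Category.assoc _ _ _).symm.trans
        ((congrArg (· ≫ homTo F e₀ e₁) (pairHom_snd a x h)).trans (h₃.symm.trans h'')))
  let z : T ⟶ (iterated f F).hom (pairObj e₀') (pairObj e₁') := pairHom (pairHom a x h) x' hz
  have z₁ : z ≫ homTo (pullbackFst (pullbackSnd (f ≫ F) F ≫ F) F) rfl rfl = pairHom a x h :=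
    pairHom_fst _ _ _
  have z₂ : z ≫ homTo (pullbackSnd (pullbackSnd (f ≫ F) F ≫ F) F) rfl rfl = x' :=
    pairHom_snd _ _ _
  have l₀ : onObj (pullbackFst (pullbackSnd (f ≫ F) F ≫ F) F ≫ functor α) (pairObj e₀') = w₀' := k₀
  have l₁ : onObj (pullbackFst (pullbackSnd (f ≫ F) F ≫ F) F ≫ functor α) (pairObj e₁') = w₁' := k₁
  have z₃ : z ≫ homTo (pullbackFst (pullbackSnd (f ≫ F) F ≫ F) F ≫ functor α) l₀ l₁ =
      hom α k₀ k₁ a x h :=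
    (congrArg (z ≫ ·) (homTo_comp_homTo rfl rfl rfl k₀ k₁ l₀ l₁)).symm.trans
      ((Category.assoc _ _ _).symm.trans (congrArg (· ≫ homTo (functor α) k₀ k₁) z₁))
  have z₄ : z ≫ homTo (pullbackFst (pullbackSnd (f ≫ F) F ≫ F) F ≫ pullbackFst (f ≫ F) F) rfl rfl =
      a :=
    (congrArg (z ≫ ·) (homTo_comp_homTo (G := pullbackFst (f ≫ F) F) rfl (x := pairObj e₀')
      (x' := pairObj e₁') rfl rfl rfl rfl rfl rfl)).symm.trans
      ((Category.assoc _ _ _).symm.trans ((congrArg (· ≫ homTo (pullbackFst (f ≫ F) F) rfl rfl)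
        z₁).trans (pairHom_fst a x h)))
  exact (pairHom_homTo (iterated_condition α) (functor_functor α _ _ (iterated_condition α)
    iterated_condition') z l₀ l₁ rfl rfl z₃ z₂ h' k₀' k₁' k₀'' k₁'').trans
      (pairHom_homTo iterated_condition' rfl z rfl rfl rfl rfl z₄ z₂ h'' k₀'' k₁'' k₀'' k₁'').symm

lemma hom_eId (h : eId V w₀ ≫ homTo (f ≫ F) h₀ h₀ = eId V x₀ ≫ homTo F rfl rfl) :
    hom α k₀ k₀ (eId V w₀) (eId V x₀) h = eId V w₀' := by
  have e : pairHom (eId V w₀) (eId V x₀) h = eId V (pairObj h₀) := by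
    apply pair_hom_ext
    · rw [pairHom_fst, eId_pairFst]
    · rw [pairHom_snd, eId_pairSnd]
  unfold hom
  rw [e]
  exact eId_homTo _ _ _

/-- The action is a `V`-functor on the pullback, where composition is componentwise. -/
lemma hom_eComp (a : T ⟶ W.hom w₀ w₁) (b : T ⟶ W.hom w₁ w₂) (x : T ⟶ C.hom x₀ x₁)
    (y : T ⟶ C.hom x₁ x₂) (h : a ≫ homTo (f ≫ F) h₀ h₁ = x ≫ homTo F rfl rfl)
    (h' : b ≫ homTo (f ≫ F) h₁ h₂ = y ≫ homTo F rfl rfl)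
    (h'' : (lift a b ≫ eComp V w₀ w₁ w₂) ≫ homTo (f ≫ F) h₀ h₂ =
      (lift x y ≫ eComp V x₀ x₁ x₂) ≫ homTo F rfl rfl) :
    hom α k₀ k₂ (lift a b ≫ eComp V w₀ w₁ w₂) (lift x y ≫ eComp V x₀ x₁ x₂) h'' =
      lift (hom α k₀ k₁ a x h) (hom α k₁ k₂ b y h') ≫ eComp V w₀' w₁' w₂' := by
  have e : pairHom (lift a b ≫ eComp V w₀ w₁ w₂) (lift x y ≫ eComp V x₀ x₁ x₂) h'' =
      lift (pairHom a x h) (pairHom b y h') ≫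
        eComp V (pairObj h₀) (pairObj h₁) (pairObj h₂) := by
    apply pair_hom_ext
    · rw [pairHom_fst, Category.assoc, eComp_pairFst, lift_map_assoc, pairHom_fst, pairHom_fst]
    · rw [pairHom_snd, Category.assoc, eComp_pairSnd, lift_map_assoc, pairHom_snd, pairHom_snd]
  unfold hom
  rw [e, Category.assoc, eComp_homTo (functor α) k₀ k₁ k₂, lift_map_assoc]

end ActionElements

end Action

end VCat

end

section

variable {V : Type u} [Category.{v} V] [CartesianMonoidalCategory V]

open CartesianMonoidalCategory SemiCartesianMonoidalCategory

namespace VCat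

/-! ### Descent along `V`-functors -/

section Descent

variable {C D : VCat.{w} V} {F : C ⟶ D}

/-- The families of hom-morphisms of `F` satisfy descent. -/
def DescendsHoms (F : C ⟶ D) : Prop :=
  ∀ (y₀ y₁ : D) {ι : Type w} (σ : ι ≃ Fiber F y₀ × Fiber F y₁),
    HasFamilyDescent (fun i => homTo F (σ i).1.2 (σ i).2.2)

variable {W : VCat.{w} V} {f : W ⟶ C}

lemma homTo_condition {w₀ w₁ : W} {x₀ x₁ : C} {z₀ z₁ : D} {p₀ : onObj F (onObj f w₀) = z₀}
    {p₁ : onObj F (onObj f w₁) = z₁} {q₀ : onObj F x₀ = z₀} {q₁ : onObj F x₁ = z₁} {T : V}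
    {a : T ⟶ W.hom w₀ w₁} {x : T ⟶ C.hom x₀ x₁}
    (h : a ≫ onHom f w₀ w₁ ≫ homTo F p₀ p₁ = x ≫ homTo F q₀ q₁)
    (h₀ : onObj (f ≫ F) w₀ = onObj F x₀) (h₁ : onObj (f ≫ F) w₁ = onObj F x₁) :
    a ≫ homTo (f ≫ F) h₀ h₁ = x ≫ homTo F rfl rfl := by
  subst q₀ q₁
  rw [← h, ← homTo_rfl]
  exact congrArg (a ≫ ·) (homTo_comp_homTo rfl rfl rfl p₀ p₁ h₀ h₁).symm

variable [HasPullbacks V] (α : PointAction F f)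

namespace ActionElements

/-- Two objects are equivalent if the action takes one to the other. -/
def setoid : Setoid W where
  r w w' := ∃ (x : C) (h : onObj (f ≫ F) w = onObj F x), obj α h = w'
  iseqv :=
    { refl := fun w => ⟨onObj f w, rfl, obj_unit α w⟩
      -- Acting with the original `onObj f w` leads back to `w`.
      symm := by
        rintro w _ ⟨x, h, rfl⟩
        have h' : onObj (f ≫ F) (obj α h) = onObj F (onObj f w) :=
          (congrArg (onObj F) (obj_str α h)).trans h.symm
        exact ⟨onObj f w, h', (obj_obj α h h' rfl).trans (obj_unit α w)⟩
      trans := by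
        rintro w _ _ ⟨x, h, rfl⟩ ⟨x', h', rfl⟩
        have h'' : onObj (f ≫ F) w = onObj F x' :=
          h.trans ((congrArg (onObj F) (obj_str α h)).symm.trans h')
        exact ⟨x', h'', (obj_obj α h h' h'').symm⟩ }

/-- The orbits of the action on objects. -/
abbrev Orbit : Type w := Quotient (setoid α)

/-- The orbit of an object. -/
abbrev orbit (w : W) : Orbit α := Quotient.mk (setoid α) w

lemma orbit_obj {w : W} {x : C} (h : onObj (f ≫ F) w = onObj F x) :
    orbit α (obj α h) = orbit α w :=
  (Quotient.sound ⟨x, h, rfl⟩ : orbit α w = orbit α (obj α h)).symm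

/-- The object of `D` over which an orbit lies. -/
def base : Orbit α → D :=
  Quotient.lift (onObj (f ≫ F)) (by
    rintro w _ ⟨x, h, rfl⟩
    exact h.trans (congrArg (onObj F) (obj_str α h)).symm)

lemma base_eq {w : W} {e : Orbit α} (h : orbit α w = e) : onObj F (onObj f w) = base α e :=
  congrArg (base α) h

lemma onObj_eq {w w' : W} {e : Orbit α} (h : orbit α w = e) (h' : orbit α w' = e) :
    onObj (f ≫ F) w = onObj F (onObj f w') :=
  (base_eq α h).trans (base_eq α h').symm

/-- Members of one orbit are related by acting with some `x'`, and the projection to `C` determines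
`x'`. Hence an orbit has at most one member over each object of `C`. -/
lemma obj_eq {w w' : W} (h : orbit α w = orbit α w') {x : C} (hx : onObj f w' = x)
    (h' : onObj (f ≫ F) w = onObj F x) : obj α h' = w' := by
  obtain ⟨x', h'', rfl⟩ := Quotient.exact h
  obtain rfl : x' = x := (obj_str α h'').symm.trans hx
  rfl

lemma orbit_injective {w w' : W} (h : orbit α w = orbit α w') (h' : onObj f w = onObj f w') :
    w = w' :=
  (obj_unit α w).symm.trans (obj_eq α h h'.symm rfl)

lemma exists_obj_eq (e : Orbit α) (x : C) (hx : onObj F x = base α e) :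
    ∃ w : W, orbit α w = e ∧ onObj f w = x := by
  obtain ⟨w, rfl⟩ := Quotient.exists_rep e
  exact ⟨obj α hx.symm, orbit_obj α _, obj_str α _⟩

/-- The objects in an orbit correspond to the objects of `C` over its base. -/
noncomputable def orbitEquiv (e : Orbit α) : {w : W // orbit α w = e} ≃ Fiber F (base α e) :=
  Equiv.ofBijective (fun w => ⟨onObj f w.1, base_eq α w.2⟩)
    ⟨fun w w' h => Subtype.ext (orbit_injective α (w.2.trans w'.2.symm) (congrArg Subtype.val h)),
      fun x => have ⟨w, hw, hx⟩ := exists_obj_eq α e x.1 x.2; ⟨⟨w, hw⟩, Subtype.ext hx⟩⟩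

/-- The action on the family of hom-objects between two orbits. -/
noncomputable def familyAction (e₀ e₁ : Orbit α) :
    FamilyAction (fun i : {w : W // orbit α w = e₀} × {w : W // orbit α w = e₁} =>
      homTo F (base_eq α i.1.2) (base_eq α i.2.2)) (fun i => onHom f i.1.1 i.2.1) where
  act {i j _} a x h := hom α (obj_eq α (i.1.2.trans j.1.2.symm) rfl (onObj_eq α i.1.2 j.1.2))
    (obj_eq α (i.2.2.trans j.2.2.symm) rfl (onObj_eq α i.2.2 j.2.2)) a x (homTo_condition h _ _)
  comp_act _ _ _ _ _ := comp_hom _ _ _ _ _ _ _ _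
  act_str _ _ _ := (congrArg _ (homTo_rfl _ _ _).symm).trans (hom_str _ _ _ _ _ _ rfl rfl)
  act_unit _ _ _ hx := hom_unit _ rfl rfl _ _ _ _ _ ((congrArg _ (homTo_rfl _ _ _)).trans hx)
  act_act _ _ _ _ _ _ := hom_hom _ _ _ _ _ _ _ _ _ _ _ _ _

/-- Descent of the family of hom-objects between two orbits provides the hom-objects of the
`V`-category sought. The last clause, invariance of the projections under the action, is what makes
identities and composition descend. -/
lemma exists_homPullback (hF : DescendsHoms F) :
    ∃ (H : Orbit α → Orbit α → V) (P : HomPullback F f H (base α) (orbit α)),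
      ∀ {w₀ w₁ w₀' w₁' : W} {e₀ e₁ : Orbit α} (l₀ : orbit α w₀ = e₀) (l₁ : orbit α w₁ = e₁)
        (l₀' : orbit α w₀' = e₀) (l₁' : orbit α w₁' = e₁) {x₀ x₁ : C}
        {h₀ : onObj (f ≫ F) w₀ = onObj F x₀} {h₁ : onObj (f ≫ F) w₁ = onObj F x₁}
        (k₀ : obj α h₀ = w₀') (k₁ : obj α h₁ = w₁') {T : V} (a : T ⟶ W.hom w₀ w₁)
        (x : T ⟶ C.hom x₀ x₁) (h : a ≫ homTo (f ≫ F) h₀ h₁ = x ≫ homTo F rfl rfl),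
        hom α k₀ k₁ a x h ≫ P.κ l₀' l₁' = a ≫ P.κ l₀ l₁ := by
  have H (e₀ e₁ : Orbit α) := hF _ _ ((orbitEquiv α e₀).prodCongr (orbitEquiv α e₁)) _
    (familyAction α e₀ e₁)
  choose H ε κ hκ hα using H
  refine ⟨H, ⟨base_eq α, exists_obj_eq α, ε, fun {w w' e e'} h h' => κ e e' (⟨w, h⟩, ⟨w', h'⟩),
    fun h h' => hκ _ _ _⟩, fun {w₀ w₁ w₀' w₁' e₀ e₁} l₀ l₁ l₀' l₁' {x₀ x₁ h₀ h₁} k₀ k₁ {T} a x h => ?_⟩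
  obtain rfl : onObj f w₀' = x₀ := by rw [← k₀, obj_str]
  obtain rfl : onObj f w₁' = x₁ := by rw [← k₁, obj_str]
  refine hα e₀ e₁ (i := (⟨w₀, l₀⟩, ⟨w₁, l₁⟩)) (j := (⟨w₀', l₀'⟩, ⟨w₁', l₁'⟩)) a x ?_
  have h' := congrArg (· ≫ eqToHom (congrArg₂ D.hom (base_eq α l₀') (base_eq α l₁'))) h
  refine Eq.trans ?_ (h'.trans ?_)
  · rw [Category.assoc, homTo_eqToHom (f ≫ F) h₀ h₁ (base_eq α l₀) (base_eq α l₁), ← homTo_rfl]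
    exact congrArg (a ≫ ·) (homTo_comp_homTo rfl _ _ _ _ _ _)
  · rw [Category.assoc, homTo_eqToHom F rfl rfl (base_eq α l₀') (base_eq α l₁')]
    rfl

/-- The two projections form the universal pair, so acting on them recovers the action functor. -/
lemma hom_pair {w₀ w₁ : W} {x₀ x₁ : C} (h₀ : onObj (f ≫ F) w₀ = onObj F x₀)
    (h₁ : onObj (f ≫ F) w₁ = onObj F x₁) :
    hom α (h₀ := h₀) (h₁ := h₁) rfl rfl (pairFst h₀ h₁) (pairSnd h₀ h₁)
      (isPullback_pair h₀ h₁ _ _ _ _).w = onHom (functor α) (pairObj h₀) (pairObj h₁) := by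
  have e : pairHom (pairFst h₀ h₁) (pairSnd h₀ h₁) (isPullback_pair h₀ h₁ _ _ _ _).w = 𝟙 _ := by
    apply pair_hom_ext <;> simp
  unfold hom
  rw [e, Category.id_comp]
  exact homTo_rfl _ _ _

lemma exists_isPullback (hs : Function.Surjective (onObj F)) (h₁ : CoversHoms F)
    (h₂ : CoversPairs F) (h₃ : EpiTriples F) (hF : DescendsHoms F) :
    ∃ (E : VCat.{w} V) (G : E ⟶ D) (k : W ⟶ E), IsPullback k f G F ∧
      functor α ≫ k = pullbackFst (f ≫ F) F ≫ k := by
  obtain ⟨H, P, hP⟩ := exists_homPullback α hF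
  -- Elements with the same image in `H` differ by the action: acting on `a` with the projection of
  -- `b` to `C` gives an element that agrees with `b` in `H` and in `C`, hence equals `b`.
  have eq_hom {w₀ w₁ w₀' w₁' : W} {e₀ e₁ : Orbit α} (l₀ : orbit α w₀ = e₀) (l₁ : orbit α w₁ = e₁)
      (l₀' : orbit α w₀' = e₀) (l₁' : orbit α w₁' = e₁) {U : V} (a : U ⟶ W.hom w₀ w₁)
      (b : U ⟶ W.hom w₀' w₁') (hab : a ≫ P.κ l₀ l₁ = b ≫ P.κ l₀' l₁') :
      ∃ h, hom α (obj_eq α (l₀.trans l₀'.symm) rfl (onObj_eq α l₀ l₀'))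
        (obj_eq α (l₁.trans l₁'.symm) rfl (onObj_eq α l₁ l₁')) a (b ≫ onHom f w₀' w₁') h = b := by
    have hc : a ≫ onHom f w₀ w₁ ≫ homTo F (P.obj_eq l₀) (P.obj_eq l₁) =
        (b ≫ onHom f w₀' w₁') ≫ homTo F (P.obj_eq l₀') (P.obj_eq l₁') := by
      rw [← (P.isPullback l₀ l₁).w, reassoc_of% hab, Category.assoc, (P.isPullback l₀' l₁').w]
    refine ⟨homTo_condition hc _ _, (P.isPullback l₀' l₁').hom_ext ?_ ?_⟩
    · rw [hP l₀ l₁ l₀' l₁', hab]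
    · exact (congrArg _ (homTo_rfl _ _ _).symm).trans (hom_str _ _ _ _ _ _ rfl rfl)
  have H' := P.exists_isPullback hs h₁ h₂ h₃ (fun w w' => orbit_injective α) ?hid ?hcomp
  case hid =>
    -- The action carries the identity of `w` to that of `w'` without changing the image in `H`.
    intro w w' e h h'
    have hc : onObj (f ≫ F) w = onObj F (onObj f w') := onObj_eq α h h'
    have he : eId V w ≫ homTo (f ≫ F) hc hc = eId V (onObj f w') ≫ homTo F rfl rfl := by
      rw [eId_homTo, eId_homTo]
    have hw : obj α hc = w' := obj_eq α (h.trans h'.symm) rfl hc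
    rw [← hP h h h' h' hw hw _ _ he, hom_eId]
  case hcomp =>
    -- Both components of `b` arise from those of `a` by the action. By `hom_eComp` the composite of
    -- `b` then arises from that of `a`, so the two have the same image in `H`.
    intro w₀ w₁ w₂ w₀' w₁' w₂' e₀ e₁ e₂ l₀ l₁ l₂ l₀' l₁' l₂' U a b hab
    obtain ⟨c₁, e₁⟩ := eq_hom l₀ l₁ l₀' l₁' (a ≫ fst _ _) (b ≫ fst _ _)
      (by simpa using congrArg (· ≫ fst _ _) hab)
    obtain ⟨c₂, e₂⟩ := eq_hom l₁ l₂ l₁' l₂' (a ≫ snd _ _) (b ≫ snd _ _)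
      (by simpa using congrArg (· ≫ snd _ _) hab)
    have c := fun h => hom_eComp α (obj_eq α (l₀.trans l₀'.symm) rfl (onObj_eq α l₀ l₀'))
      (obj_eq α (l₁.trans l₁'.symm) rfl (onObj_eq α l₁ l₁'))
      (obj_eq α (l₂.trans l₂'.symm) rfl (onObj_eq α l₂ l₂')) _ _ _ _ c₁ c₂ h
    have hl (X Y : V) (t : U ⟶ X ⊗ Y) : lift (t ≫ fst X Y) (t ≫ snd X Y) = t := by
      apply CartesianMonoidalCategory.hom_ext <;> simp
    rw [e₁, e₂, hl, hl] at c
    have hc : (a ≫ eComp V w₀ w₁ w₂) ≫ homTo (f ≫ F) (onObj_eq α l₀ l₀') (onObj_eq α l₂ l₂') =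
        (lift ((b ≫ fst _ _) ≫ onHom f w₀' w₁') ((b ≫ snd _ _) ≫ onHom f w₁' w₂') ≫
          eComp V _ _ _) ≫ homTo F rfl rfl := by
      rw [Category.assoc, Category.assoc, eComp_homTo F rfl rfl rfl,
        eComp_homTo (f ≫ F) _ (onObj_eq α l₁ l₁') _, lift_map_assoc, ← c₁, ← c₂,
        ← lift_map_assoc, hl]
    rw [← Category.assoc, ← Category.assoc, ← c hc, hP l₀ l₂ l₀' l₂']
  obtain ⟨E, G, k, hk, hk'⟩ := H'
  refine ⟨E, G, k, hk, hk' _ _ (fun s : PullbackObj (f ≫ F) F => orbit_obj α s.2)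
    (fun s s' : PullbackObj (f ≫ F) F => ?_)⟩
  have e := hP rfl rfl (orbit_obj α s.2) (orbit_obj α s'.2) rfl rfl (pairFst s.2 s'.2)
    (pairSnd s.2 s'.2) (isPullback_pair s.2 s'.2 _ _ _ _).w
  rw [hom_pair] at e
  exact e.trans (congrArg (· ≫ P.κ rfl rfl) (homTo_rfl (pullbackFst (f ≫ F) F) _ _))

end ActionElements

/-- Surjectivity and the two covering conditions make every pullback of `F` an effective
epimorphism; epimorphic triples and descent of homs are needed in addition to realize descent data.
-/
theorem isEffectiveDescent (hs : Function.Surjective (onObj F)) (h₁ : CoversHoms F)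
    (h₂ : CoversPairs F) (h₃ : EpiTriples F) (hF : DescendsHoms F) : IsEffectiveDescent F := by
  refine isEffectiveDescent_of (fun {Z} g => ?_) (fun A => ?_)
  · let P : HomPullback F (pullbackSnd g F) Z.hom (onObj g) (onObj (pullbackFst g F)) :=
      { obj_eq := fun {w e} h => by
          have h' := congrArg (fun K : pullbackCat g F ⟶ D => onObj K w) (pullback_condition g F)
          exact h'.symm.trans (congrArg (onObj g) h)
        exists_obj := fun e x hx => ⟨pairObj hx.symm, rfl, rfl⟩
        ε := onHom g
        κ := fun h h' => homTo (pullbackFst g F) h h'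
        isPullback := fun {w w' e e'} h h' => by
          subst h h'
          have e := isPullback_pair (show PullbackObj g F from w).2
            (show PullbackObj g F from w').2 rfl rfl
            (show PullbackObj g F from w).2.symm (show PullbackObj g F from w').2.symm
          have e₁ : pairSnd (show PullbackObj g F from w).2 (show PullbackObj g F from w').2 =
            onHom (pullbackSnd g F) w w' := homTo_rfl _ _ _
          rw [e₁, homTo_rfl] at e
          exact e }
    exact ⟨_, _, _, isPullback g F, existsUnique_desc (P.surjective hs) (P.isCovering_homs h₁)
      (P.isCovering_pairs h₂)⟩
  · obtain ⟨E, G, k, hk, hk'⟩ := ActionElements.exists_isPullback A.pointAction hs h₁ h₂ h₃ hF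
    refine ⟨E, G, k, hk, ?_⟩
    -- The pullback chosen in the descent datum need not be the explicit `pullbackCat`; `t` compares
    -- them.
    let t : pullback (A.str ≫ F) F ⟶ pullbackCat (A.str ≫ F) F :=
      pullbackLift (pullback.fst _ _) (pullback.snd _ _) pullback.condition
    have ht : t ≫ ActionElements.functor A.pointAction = A.act := by
      refine (A.pointAction.comp_act_eq _ _ (pullbackLift_fst _ _ _) (pullbackLift_snd _ _ _)
        pullback.condition).trans ?_
      change pullback.lift _ _ _ ≫ A.act = A.act
      rw [pullback.lift_fst_snd, Category.id_comp]
    have ht' : t ≫ pullbackFst (A.str ≫ F) F = pullback.fst (A.str ≫ F) F := pullbackLift_fst _ _ _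
    rw [← ht, Category.assoc, hk', ← Category.assoc, ht']

end Descent

end VCat

end

section

variable {V : Type u} [Category.{v} V] [CartesianMonoidalCategory V]

open CartesianMonoidalCategory SemiCartesianMonoidalCategory

namespace VCat

/-! ### Families of factorizations -/

section Families

variable {C D : VCat.{w} V} {F : C ⟶ D}

lemma onHomPair_eqToHom {x₀ x₁ x₂ : C} {y₀ y₁ y₂ : D} (h₀ : onObj F x₀ = y₀) (h₁ : onObj F x₁ = y₁)
    (h₂ : onObj F x₂ = y₂)
    (e : D.homPair (onObj F x₀) (onObj F x₁) (onObj F x₂) = D.homPair y₀ y₁ y₂) :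
    onHomPair F x₀ x₁ x₂ ≫ eqToHom e = homTo F h₁ h₂ ⊗ₘ homTo F h₀ h₁ := by
  subst h₀ h₁ h₂
  rw [eqToHom_refl, Category.comp_id, homTo_rfl, homTo_rfl]

lemma onHomTriple_eqToHom {x₀ x₁ x₂ x₃ : C} {y₀ y₁ y₂ y₃ : D} (h₀ : onObj F x₀ = y₀)
    (h₁ : onObj F x₁ = y₁) (h₂ : onObj F x₂ = y₂) (h₃ : onObj F x₃ = y₃)
    (e : D.homTriple (onObj F x₀) (onObj F x₁) (onObj F x₂) (onObj F x₃) = D.homTriple y₀ y₁ y₂ y₃) :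
    onHomTriple F x₀ x₁ x₂ x₃ ≫ eqToHom e =
      homTo F h₂ h₃ ⊗ₘ homTo F h₁ h₂ ⊗ₘ homTo F h₀ h₁ := by
  subst h₀ h₁ h₂ h₃
  rw [eqToHom_refl, Category.comp_id, homTo_rfl, homTo_rfl, homTo_rfl]

/-- The interchange of the factors of a product. -/
def swap (X Y : V) : X ⊗ Y ≅ Y ⊗ X where
  hom := lift (snd _ _) (fst _ _)
  inv := lift (snd _ _) (fst _ _)

/-- The reversal of the factors of a ternary product. -/
def reverse (X Y Z : V) : X ⊗ Y ⊗ Z ≅ Z ⊗ Y ⊗ X where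
  hom := lift (snd _ _ ≫ snd _ _) (lift (snd _ _ ≫ fst _ _) (fst _ _))
  inv := lift (snd _ _ ≫ snd _ _) (lift (snd _ _ ≫ fst _ _) (fst _ _))

/-- Enriched composition takes `D(y₀, y₁) ⊗ D(y₁, y₂)`, the reverse of the order in the hypotheses
on pairs and triples, so the factors have to be interchanged. -/
lemma tensorHom_swap {X Y X' Y' : V} (a : X ⟶ X') (b : Y ⟶ Y') :
    (a ⊗ₘ b) ≫ (swap X' Y').hom = (swap X Y).hom ≫ (b ⊗ₘ a) := by
  apply CartesianMonoidalCategory.hom_ext <;> simp [swap]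

lemma tensorHom_reverse {X Y Z X' Y' Z' : V} (a : X ⟶ X') (b : Y ⟶ Y') (c : Z ⟶ Z') :
    (a ⊗ₘ b ⊗ₘ c) ≫ (reverse X' Y' Z').hom = (reverse X Y Z).hom ≫ (c ⊗ₘ b ⊗ₘ a) := by
  apply CartesianMonoidalCategory.hom_ext
  · simp [reverse]
  · apply CartesianMonoidalCategory.hom_ext <;> simp [reverse]

variable [Regular V]

section

variable {fac : ∀ x₀ x₁ : C, RegularEpiMonoFactorisation (onHom F x₀ x₁)}

omit [Regular V] in
lemma e_overHom (fac : ∀ x₀ x₁ : C, RegularEpiMonoFactorisation (onHom F x₀ x₁)) {y₀ y₁ : D}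
    (q : Fiber F y₀ × Fiber F y₁) :
    (fac q.1 q.2).e ≫ overHom F (fun x₀ x₁ => (fac x₀ x₁).m) y₀ y₁ q = homTo F q.1.2 q.2.2 := by
  unfold overHom
  rw [← Category.assoc, (fac q.1 q.2).fac]
  rfl

lemma coversHoms (h : ∀ y₀ y₁ : D, IsEffectiveDescent
    (famHom (overHom F (fun x₀ x₁ => (fac x₀ x₁).m) y₀ y₁))) : CoversHoms F := fun y₀ y₁ => by
  have (q : Fiber F y₀ × Fiber F y₁) : IsRegularEpi (fac q.1 q.2).e := (fac _ _).isRegularEpi_e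
  simpa only [e_overHom] using (h y₀ y₁).isCovering.regularEpi_comp fun q => (fac q.1 q.2).e

lemma surjective_onObj (h : ∀ y₀ y₁ : D, IsEffectiveDescent
    (famHom (overHom F (fun x₀ x₁ => (fac x₀ x₁).m) y₀ y₁))) : Function.Surjective (onObj F) :=
  fun y => have ⟨q⟩ := (h y y).nonempty_index; ⟨q.1, q.1.2⟩

/-- Two-stage descent: along the regular epimorphisms by condition 1, then along the family of
images by condition 2. -/
lemma descendsHoms (hP : ∀ x₀ x₁ : C, IsEffectiveDescent (fac x₀ x₁).e)
    (h : ∀ y₀ y₁ : D, IsEffectiveDescent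
      (famHom (overHom F (fun x₀ x₁ => (fac x₀ x₁).m) y₀ y₁))) : DescendsHoms F :=
  fun y₀ y₁ ι σ => by
    have (i : ι) : IsRegularEpi (fac (σ i).1 (σ i).2).e := (fac _ _).isRegularEpi_e
    have hd : HasFamilyDescent fun i => (fac (σ i).1 (σ i).2).e ≫
        overHom F (fun x₀ x₁ => (fac x₀ x₁).m) y₀ y₁ (σ i) :=
      HasFamilyDescent.regularEpi_comp ((h y₀ y₁).hasFamilyDescent σ)
        fun i => (hP (σ i).1 (σ i).2).hasDescent
    simp only [e_overHom] at hd
    exact @hd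

end

lemma coversPairs {fac : ∀ x₀ x₁ x₂ : C, RegularEpiMonoFactorisation (onHomPair F x₀ x₁ x₂)}
    (h : ∀ y₀ y₁ y₂ : D, StableJoinIs
      (overHomPair F (fun x₀ x₁ x₂ => (fac x₀ x₁ x₂).m) y₀ y₁ y₂)) : CoversPairs F :=
  fun y₀ y₁ y₂ => by
    have (q : Fiber F y₀ × Fiber F y₁ × Fiber F y₂) : IsRegularEpi (fac q.1 q.2.1 q.2.2).e :=
      (fac _ _ _).isRegularEpi_e
    refine (((h y₀ y₁ y₂).isCovering.regularEpi_comp fun q => (fac q.1 q.2.1 q.2.2).e).comp_iso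
      (swap _ _)).of_factors fun q => ⟨q, (swap _ _).hom, ?_⟩
    unfold overHomPair
    rw [← tensorHom_swap, ← onHomPair_eqToHom q.1.2 q.2.1.2 q.2.2.2, ← Category.assoc (fac _ _ _).e,
      (fac _ _ _).fac]

lemma epiTriples
    {fac : ∀ x₀ x₁ x₂ x₃ : C, RegularEpiMonoFactorisation (onHomTriple F x₀ x₁ x₂ x₃)}
    (h : ∀ y₀ y₁ y₂ y₃ : D, IsAlmostDescent
      (famHom (overHomTriple F (fun x₀ x₁ x₂ x₃ => (fac x₀ x₁ x₂ x₃).m) y₀ y₁ y₂ y₃))) :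
    EpiTriples F :=
  fun y₀ y₁ y₂ y₃ => by
    have (q : Fiber F y₀ × Fiber F y₁ × Fiber F y₂ × Fiber F y₃) :
        IsRegularEpi (fac q.1 q.2.1 q.2.2.1 q.2.2.2).e := (fac _ _ _ _).isRegularEpi_e
    refine (((h y₀ y₁ y₂ y₃).isUnivEpi.regularEpi_comp
      fun q => (fac q.1 q.2.1 q.2.2.1 q.2.2.2).e).comp_iso (reverse _ _ _)).of_factors
        fun q => ⟨q, (reverse _ _ _).hom, ?_⟩
    unfold overHomTriple
    rw [← tensorHom_reverse, ← onHomTriple_eqToHom q.1.2 q.2.1.2 q.2.2.1.2 q.2.2.2.2,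
      ← Category.assoc (fac _ _ _ _).e, (fac _ _ _ _).fac]

end Families

end VCat

end

theorem mainTheorem1 {V : Type u} [Category.{v} V] [CartesianMonoidalCategory V] [Regular V]
    {C D : VCat.{w} V} (F : C ⟶ D)
    -- the (regular epi, mono)-factorizations
    (fac₁ : ∀ x₀ x₁ : C, RegularEpiMonoFactorisation (VCat.onHom F x₀ x₁))
    (fac₂ : ∀ x₀ x₁ x₂ : C, RegularEpiMonoFactorisation (VCat.onHomPair F x₀ x₁ x₂))
    (fac₃ : ∀ x₀ x₁ x₂ x₃ : C, RegularEpiMonoFactorisation (VCat.onHomTriple F x₀ x₁ x₂ x₃))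
    -- (i)
    (hP : ∀ x₀ x₁ : C, IsEffectiveDescent (fac₁ x₀ x₁).e)
    -- (ii)
    (hI : ∀ y₀ y₁ : D, IsEffectiveDescent
      (famHom (VCat.overHom F (fun x₀ x₁ => (fac₁ x₀ x₁).m) y₀ y₁)))
    -- (iii)
    (hJoin : ∀ y₀ y₁ y₂ : D, StableJoinIs
      (VCat.overHomPair F (fun x₀ x₁ x₂ => (fac₂ x₀ x₁ x₂).m) y₀ y₁ y₂))
    -- (iv)
    (hAlmost : ∀ y₀ y₁ y₂ y₃ : D, IsAlmostDescent
      (famHom (VCat.overHomTriple F (fun x₀ x₁ x₂ x₃ => (fac₃ x₀ x₁ x₂ x₃).m) y₀ y₁ y₂ y₃))) :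
    IsEffectiveDescent F := by
  -- Condition 2 enters three times: for surjectivity on objects, for covering the homs, and, with
  -- condition 1, for descent of hom-objects.
  exact VCat.isEffectiveDescent (VCat.surjective_onObj hI) (VCat.coversHoms hI)
    (VCat.coversPairs hJoin) (VCat.epiTriples hAlmost) (VCat.descendsHoms hP hI)
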